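/- Let $n\ge 1$ and let $D=G/K\subset\mathbb C^n$ be a bounded symmetric domain: a bounded domain on which the group $G=\mathrm{Aut}(D)$ of biholomorphic self-maps acts transitively and such that every point of $D$ is an isolated fixed point of an involution in $G$. Let $J(g,z)$ be the complex Jacobian determinant of $g\in G$ at $z\in D$, let $dV_e$ be the Euclidean volume, let $\mathcal K(z,w)$ be the Bergman kernel of $D$ (the Hermitian reproducing kernel of the space of holomorphic functions on $D$ that are square integrable with respect to $dV_e$), and put $dV(z)=\mathcal K(z,z)\,dV_e(z)$. For a positive integer $k$ let $c(D,k)$ be the constant determined by $$c(D,k)\int_D\frac{\mathcal K(z,w)^k\,\mathcal K(w,z)^k}{\mathcal K(w,w)^k}\,dV(w)=\mathcal K(z,z)^k\qquad(z\in D).$$ Let $\Gamma$ be a discrete subgroup of $G$ (for the compact-open topology) such that $\Gamma\backslash D$ is compact and smooth, that is, $\Gamma$ acts freely on $D$. Let $m$ be a positive integer and $\rho:\Gamma\to U(m)$ a unitary representation. Let $\mathcal A(\Gamma,m,k,\rho)$ be the space of holomorphic maps $F:D\to\mathbb C^m$ with $J(\gamma,z)^kF(\gamma z)=\rho(\gamma)F(z)$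 for all $\gamma\in\Gamma$, $z\in D$, with the Petersson inner product $$(F,G)=\int_{\Gamma\backslash D}F(z)^T\,\overline{G(z)}\,\mathcal K(z,z)^{-k}\,dV(z),$$ the integral being taken over any measurable fundamental domain of $\Gamma$ in $D$. For $p\in D$ and $j\in\{1,\dots,m\}$ let $\mathcal T_p(z)\in\mathbb C^m$ be the vector whose $j$-th component is $\mathcal K(z,p)^k$ and whose other components are $0$, and consider the series $$\Theta_p^{(j;k)}(z)=c(D,k)\sum_{\gamma\in\Gamma}\rho(\gamma^{-1})\,\mathcal T_p(\gamma z)\,J(\gamma,z)^k .$$ Then there is $k_0$ such that for all integers $k\ge k_0$, all $j\in\{1,\dots,m\}$ and all $p\in D$: (i) the series $\Theta_p^{(j;k)}$ converges absolutely and uniformly on compact subsets of $D$ (the series of norms also converges uniformly there); (ii) $\Theta_p^{(j;k)}\in\mathcal A(\Gamma,m,k,\rho)$, and for every $H=(H_1,\dots,H_m)^T\in\mathcal A(\Gamma,m,k,\rho)$ the integral that defines $(H,\Theta_p^{(j;k)})$ converges absolutely and $$(H,\Theta_p^{(j;k)})=H_j(p).$$ -/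

import Mathlib

open MeasureTheory

namespace PoincareSeries

/-- A function `f : D → F` on a (usually open) subset `D` of `ℂⁿ` is holomorphic. Differentiability
is tested on the extension of `f` by zero, within `D`. -/
def IsHolomorphic {n : ℕ} {D : Set (Fin n → ℂ)} {F : Type*} [NormedAddCommGroup F]
    [NormedSpace ℂ F] (f : D → F) : Prop :=
  DifferentiableOn ℂ (Function.extend Subtype.val f 0) D

section helpers

variable {n : ℕ} {D : Set (Fin n → ℂ)} {F : Type*} [NormedAddCommGroup F] [NormedSpace ℂ F]

theorem extend_coe (f : D → F) (z : D) :
    Function.extend Subtype.val f 0 (z : Fin n → ℂ) = f z :=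
  Subtype.val_injective.extend_apply f 0 z

theorem isHolomorphic_of_eqOn {f : D → F} {u : (Fin n → ℂ) → F} (hu : DifferentiableOn ℂ u D)
    (h : ∀ z : D, f z = u z) : IsHolomorphic f :=
  hu.congr fun z hz => (extend_coe f ⟨z, hz⟩).trans (h ⟨z, hz⟩)

theorem IsHolomorphic.continuous {f : D → F} (hf : IsHolomorphic f) : Continuous f := by
  have h := continuousOn_iff_continuous_domRestrict.1 (DifferentiableOn.continuousOn hf)
  exact h.congr fun z => extend_coe f z

theorem IsHolomorphic.comp_val {f : D → F} (hf : IsHolomorphic f) {g : D → D}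
    (hg : IsHolomorphic fun z => (g z : Fin n → ℂ)) : IsHolomorphic fun z => f (g z) := by
  refine isHolomorphic_of_eqOn (DifferentiableOn.comp hf hg ?_) ?_
  · intro z hz
    rw [extend_coe (fun z : D => (g z : Fin n → ℂ)) ⟨z, hz⟩]
    exact (g ⟨z, hz⟩).2
  · intro z
    simp only [Function.comp_apply]
    rw [extend_coe (fun z : D => (g z : Fin n → ℂ)) z, extend_coe]

end helpers

/-- The group `Aut(D)` of biholomorphic self-maps of `D`. -/
def Aut {n : ℕ} (D : Set (Fin n → ℂ)) : Subgroup (Equiv.Perm D) where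
  carrier := {g | IsHolomorphic (fun z : D => ((g z : D) : Fin n → ℂ)) ∧
    IsHolomorphic (fun z : D => ((g⁻¹ z : D) : Fin n → ℂ))}
  one_mem' := by
    constructor <;>
    · refine isHolomorphic_of_eqOn (u := id) differentiableOn_id ?_
      intro z
      simp
  mul_mem' := by
    rintro a b ⟨ha, ha'⟩ ⟨hb, hb'⟩
    refine ⟨ha.comp_val hb, ?_⟩
    have h := hb'.comp_val ha'
    simpa only [mul_inv_rev, Equiv.Perm.mul_apply] using h
  inv_mem' := by
    rintro a ⟨ha, ha'⟩
    exact ⟨ha', by simpa using ha⟩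

/-- The element `g` of `Aut(D)` as a continuous map `D → D`. -/
noncomputable def Aut.toContinuousMap {n : ℕ} {D : Set (Fin n → ℂ)} (g : Aut D) : C(D, D) where
  toFun z := g • z
  continuous_toFun := Continuous.subtype_mk (IsHolomorphic.continuous g.2.1) _

/-- `Aut(D)` carries the compact-open topology. -/
noncomputable instance {n : ℕ} (D : Set (Fin n → ℂ)) : TopologicalSpace (Aut D) :=
  TopologicalSpace.induced Aut.toContinuousMap inferInstance

/-- A bounded symmetric domain `D = G/K ⊂ ℂⁿ`: a bounded domain on which `G = Aut(D)` acts
transitively and each of whose points is an isolated fixed point of an involution in `Aut(D)`. -/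
structure IsBoundedSymmetricDomain {n : ℕ} (D : Set (Fin n → ℂ)) : Prop where
  isOpen : IsOpen D
  isConnected : IsConnected D
  isBounded : Bornology.IsBounded D
  transitive : ∀ z w : D, ∃ g : Aut D, g • z = w
  symmetric : ∀ p : D, ∃ s : Aut D, s * s = 1 ∧ s • p = p ∧
    ∀ᶠ z in nhds p, s • z = z → z = p

/-- `Γ` is a discrete subgroup of `Aut(D)` such that `Γ \ D` is compact and smooth, i.e. `Γ` acts
without fixed points, so that `D → Γ \ D` is a covering. -/
structure IsSmoothCocompactLattice {n : ℕ} {D : Set (Fin n → ℂ)} (Γ : Subgroup (Aut D)) :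
    Prop where
  discrete : DiscreteTopology Γ
  free : ∀ (γ : Γ) (z : D), γ • z = z → γ = 1
  compact : CompactSpace (MulAction.orbitRel.Quotient Γ D)

/-- The complex Jacobian `J(g, z)` of `g : D → D` at `z`. -/
noncomputable def jacobian {n : ℕ} {D : Set (Fin n → ℂ)} (g : Aut D) (z : D) : ℂ :=
  (fderiv ℂ (Function.extend Subtype.val (fun w : D => ((g • w : D) : Fin n → ℂ)) 0)
    (z : Fin n → ℂ)).det

/-- The Euclidean volume `dV_e` on `D`. -/
noncomputable def eucVolume {n : ℕ} (D : Set (Fin n → ℂ)) : Measure D :=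
  (volume : Measure (Fin n → ℂ)).comap Subtype.val

/-- Holomorphic functions on `D`, square integrable for the Euclidean volume `dV_e`. -/
def IsBergmanFunction {n : ℕ} {D : Set (Fin n → ℂ)} (f : D → ℂ) : Prop :=
  IsHolomorphic f ∧ MemLp f 2 (eucVolume D)

/-- `K` is a Hermitian reproducing kernel of the space of square integrable holomorphic functions
on `D`. There is at most one such `K` (see `IsBergmanKernel.unique`). -/
structure IsBergmanKernel {n : ℕ} (D : Set (Fin n → ℂ)) (K : D → D → ℂ) : Prop where
  mem : ∀ w : D, IsBergmanFunction fun z => K z w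
  hermitian : ∀ z w : D, K z w = star (K w z)
  reproducing : ∀ f : D → ℂ, IsBergmanFunction f → ∀ z : D, f z = ∫ w : D, f w * K z w ∂(eucVolume D)

theorem IsBergmanKernel.unique {n : ℕ} {D : Set (Fin n → ℂ)} {K L : D → D → ℂ}
    (hK : IsBergmanKernel D K) (hL : IsBergmanKernel D L) : K = L := by
  funext z w
  have h1 := hL.reproducing _ (hK.mem w) z
  have h2 := hK.reproducing _ (hL.mem z) w
  rw [h1, hL.hermitian z w, h2]
  simp only [RCLike.star_def]
  rw [← integral_conj]
  congr 1
  funext u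
  rw [map_mul, hL.hermitian z u, hK.hermitian u w]
  simp [mul_comm]

open Classical in
/-- The Bergman kernel `𝒦` of `D`. -/
noncomputable def bergmanKernel {n : ℕ} (D : Set (Fin n → ℂ)) : D → D → ℂ :=
  if h : ∃ K, IsBergmanKernel D K then h.choose else 0

/-- The invariant volume `dV(z) = 𝒦(z,z) dV_e(z)` on `D`. -/
noncomputable def invVolume {n : ℕ} (D : Set (Fin n → ℂ)) : Measure D :=
  (eucVolume D).withDensity fun z => ENNReal.ofReal (bergmanKernel D z z).re

open Classical in
/-- The constant `c(D,k)`, determined by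
`c(D,k) ∫_D 𝒦(z,w)^k 𝒦(w,z)^k / 𝒦(w,w)^k dV(w) = 𝒦(z,z)^k` for all `z ∈ D`. -/
noncomputable def bergmanConst {n : ℕ} (D : Set (Fin n → ℂ)) (k : ℕ) : ℝ :=
  if h : ∃ c : ℝ, ∀ z : D,
      (c : ℂ) * ∫ w : D, bergmanKernel D z w ^ k * bergmanKernel D w z ^ k /
        bergmanKernel D w w ^ k ∂(invVolume D) = bergmanKernel D z z ^ k
  then h.choose else 0

/-- The space `𝒜(Γ,m,k,ρ)` of holomorphic `F : D → ℂᵐ` such that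
`J(γ,z)^k F(γz) = ρ(γ) F(z)` for all `γ ∈ Γ`, `z ∈ D`. -/
def automorphicForms {n m : ℕ} {D : Set (Fin n → ℂ)} (Γ : Subgroup (Aut D)) (k : ℕ)
    (ρ : Γ →* Matrix.unitaryGroup (Fin m) ℂ) : Submodule ℂ (D → Fin m → ℂ) where
  carrier := {F | IsHolomorphic F ∧ ∀ (γ : Γ) (z : D),
    jacobian (γ : Aut D) z ^ k • F (γ • z) =
      (ρ γ : Matrix (Fin m) (Fin m) ℂ).mulVec (F z)}
  add_mem' := by
    rintro F G ⟨hF, hF'⟩ ⟨hG, hG'⟩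
    refine ⟨isHolomorphic_of_eqOn (DifferentiableOn.add hF hG) fun z => ?_, fun γ z => ?_⟩
    · simp only [Pi.add_apply, extend_coe]
    · simp only [Pi.add_apply, smul_add, hF', hG', Matrix.mulVec_add]
  zero_mem' := by
    refine ⟨isHolomorphic_of_eqOn (u := 0) (differentiableOn_const 0) fun z => rfl, fun γ z => ?_⟩
    simp
  smul_mem' := by
    rintro a F ⟨hF, hF'⟩
    refine ⟨isHolomorphic_of_eqOn (DifferentiableOn.const_smul hF a) fun z => ?_, fun γ z => ?_⟩
    · simp only [Pi.smul_apply, extend_coe]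
    · rw [Pi.smul_apply, Pi.smul_apply, smul_comm, hF', Matrix.mulVec_smul]

/-- The function `F(z)ᵀ \overline{G(z)} 𝒦(z,z)^{-k}`. -/
noncomputable def peterssonDensity {n m : ℕ} {D : Set (Fin n → ℂ)} (k : ℕ)
    (F G : D → Fin m → ℂ) (z : D) : ℂ :=
  dotProduct (F z) (star (G z)) * (bergmanKernel D z z ^ k)⁻¹

/-- The Petersson inner product `(F, G) = ∫_{Γ \ D} F(z)ᵀ \overline{G(z)} 𝒦(z,z)^{-k} dV(z)`,
computed on a fundamental domain `𝓕` of `Γ`. -/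
noncomputable def petersson {n m : ℕ} {D : Set (Fin n → ℂ)} (𝓕 : Set D) (k : ℕ)
    (F G : D → Fin m → ℂ) : ℂ :=
  ∫ z in 𝓕, peterssonDensity k F G z ∂(invVolume D)

/-- The vector `𝒯_p(z) ∈ ℂᵐ` with `j`-th component `𝒦(z,p)^k` and all other components zero. -/
noncomputable def seed {n m : ℕ} {D : Set (Fin n → ℂ)} (k : ℕ) (j : Fin m) (p z : D) :
    Fin m → ℂ :=
  Pi.single j (bergmanKernel D z p ^ k)

/-- The term `c(D,k) ρ(γ⁻¹) 𝒯_p(γz) J(γ,z)^k` of the Poincaré series. -/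
noncomputable def poincareTerm {n m : ℕ} {D : Set (Fin n → ℂ)} {Γ : Subgroup (Aut D)} (k : ℕ)
    (ρ : Γ →* Matrix.unitaryGroup (Fin m) ℂ) (j : Fin m) (p : D) (γ : Γ) (z : D) :
    Fin m → ℂ :=
  ((bergmanConst D k : ℂ) * jacobian (γ : Aut D) z ^ k) •
    (ρ γ⁻¹ : Matrix (Fin m) (Fin m) ℂ).mulVec (seed k j p (γ • z))

/-- The Poincaré series `Θ_p^{(j;k)}(z) = c(D,k) ∑_γ ρ(γ⁻¹) 𝒯_p(γz) J(γ,z)^k`. -/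
noncomputable def poincareSeries {n m : ℕ} {D : Set (Fin n → ℂ)} {Γ : Subgroup (Aut D)} (k : ℕ)
    (ρ : Γ →* Matrix.unitaryGroup (Fin m) ℂ) (j : Fin m) (p z : D) : Fin m → ℂ :=
  ∑' γ : Γ, poincareTerm k ρ j p γ z

end PoincareSeries

/-!
The whole argument rests on a reproducing formula of weight `k`. Holomorphic functions that are
square integrable for `𝒦(z,z)^{-k} dV` have a reproducing kernel, and transitivity of `Aut(D)`
forces its diagonal to be a multiple of `𝒦(z,z)^k`; by polarization the kernel itself is
`c(D,k) 𝒦(z,w)^k`. An automorphic form `f` satisfies only `|f|² ≤ M 𝒦(z,z)^k`, which does not make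
it square integrable, but `f 𝒦(·,p)^l` is, in weight `k + l`, for every `l ≥ 1`. This says that the
reproducing integrand of `f` at `p` has the expected moments against the powers of
`β = |𝒦(p,w)|² / (𝒦(p,p) 𝒦(w,w)) ∈ [0,1]`, and letting `N → ∞` in the integrals against `(1-β)^N`
yields the reproducing formula for `f` itself.

A discrete `Γ` acts properly discontinuously, because `Aut(D)` preserves the Carathéodory
pseudo-distance. Hence the functions `𝒦(γz,p) J(γ,z)` are square summable over `Γ`, locally
uniformly in `z`: their squares are controlled by integrals of `|𝒦(·,p)|²` over the translates of a
compact set, which overlap boundedly often. This gives convergence for `k ≥ 2`, and unfolding the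
Petersson integral over `Γ` turns `(H, Θ_p^{(j;k)})` into the reproducing integral of `H_j`.
-/

namespace PoincareSeries

open Metric Set Filter
open scoped Topology ENNReal NNReal ComplexConjugate

/-! ### Holomorphic maps of several variables -/

section SeveralVariables

variable {E G : Type*} [NormedAddCommGroup E] [NormedSpace ℂ E] [NormedAddCommGroup G]
  [NormedSpace ℂ G]

theorem exists_norm_le_on_ball {X Y : Type*} [PseudoMetricSpace X] [SeminormedAddCommGroup Y]
    {f : X → Y} {c : X} (hf : ContinuousAt f c) : ∃ r > 0, ∃ M, ∀ z ∈ ball c r, ‖f z‖ ≤ M := by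
  obtain ⟨r, hr, hfr⟩ := Metric.mem_nhds_iff.1
    (hf.norm.eventually (gt_mem_nhds (lt_add_one ‖f c‖)))
  exact ⟨r, hr, _, fun z hz => (hfr hz).le⟩

theorem norm_fderiv_le_of_norm_le {f : E → G} {c : E} {r M : ℝ} (hr : 0 < r)
    (hd : DifferentiableOn ℂ f (ball c r)) (hM : ∀ z ∈ ball c r, ‖f z‖ ≤ M) :
    ‖fderiv ℂ f c‖ ≤ 2 * M / r := by
  refine Complex.norm_fderiv_le_div_of_mapsTo_ball hd (fun z hz => ?_) hr
  rw [mem_closedBall, dist_eq_norm]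
  linarith [norm_sub_le (f z) (f c), hM z hz, hM c (mem_ball_self hr)]

theorem norm_sub_sub_fderiv_le {f : E → G} {c z : E} {r M : ℝ} (hr : 0 < r)
    (hd : DifferentiableOn ℂ f (ball c r)) (hM : ∀ z ∈ ball c r, ‖f z‖ ≤ M)
    (hz : z ∈ ball c r) :
    ‖f z - f c - fderiv ℂ f c (z - c)‖ ≤ 4 * M * (‖z - c‖ / r) ^ 2 := by
  have hM₀ : 0 ≤ M := (norm_nonneg _).trans (hM c (mem_ball_self hr))
  have hlin : ∀ w ∈ ball c r, ‖fderiv ℂ f c (w - c)‖ ≤ 2 * M := fun w hw =>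
    calc ‖fderiv ℂ f c (w - c)‖ ≤ ‖fderiv ℂ f c‖ * ‖w - c‖ := ContinuousLinearMap.le_opNorm _ _
      _ ≤ 2 * M / r * r := by
        gcongr
        · exact norm_fderiv_le_of_norm_le hr hd hM
        · exact (mem_ball_iff_norm.1 hw).le
      _ = 2 * M := by field_simp
  have hmaps : MapsTo (fun w => f w - fderiv ℂ f c (w - c)) (ball c r)
      (closedBall (f c - fderiv ℂ f c (c - c)) (4 * M)) := by
    intro w hw
    rw [mem_closedBall, dist_eq_norm, sub_self, map_zero, sub_zero]
    linarith [norm_sub_le (f w - fderiv ℂ f c (w - c)) (f c),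
      norm_sub_le (f w) (fderiv ℂ f c (w - c)), hM w hw, hM c (mem_ball_self hr), hlin w hw]
  have hlittle : (fun w => f w - fderiv ℂ f c (w - c) - (f c - fderiv ℂ f c (c - c)))
      =o[𝓝 c] fun w => ‖w - c‖ ^ 1 := by
    have hfc := (hd.differentiableAt (ball_mem_nhds c hr)).hasFDerivAt.isLittleO
    simp only [sub_self, map_zero, sub_zero, pow_one]
    exact hfc.norm_right.congr_left fun w => sub_right_comm _ _ _
  have key := Complex.dist_le_mul_div_pow_of_mapsTo_ball_of_isLittleO
    (hd.sub (by fun_prop)) hmaps hlittle hz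
  simp only [Pi.sub_apply, dist_eq_norm, sub_self, map_zero, sub_zero] at key
  rwa [sub_right_comm] at key

theorem differentiableAt_of_tendstoUniformlyOn_ball [CompleteSpace G] {ι : Type*} {φ : Filter ι}
    [NeBot φ] {F : ι → E → G} {f : E → G} {c : E} {r : ℝ} (hr : 0 < r)
    (hF : TendstoUniformlyOn F f φ (ball c r))
    (hd : ∀ᶠ i in φ, DifferentiableOn ℂ (F i) (ball c r)) : DifferentiableAt ℂ f c := by
  have hsub : ∀ z ∈ ball c (r / 2), ball z (r / 2) ⊆ ball c r := fun z hz =>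
    ball_subset_ball' (by linarith [mem_ball.1 hz])
  have hcauchy : UniformCauchySeqOn (fun i z => fderiv ℂ (F i) z) φ (ball c (r / 2)) := by
    intro u hu
    obtain ⟨ε, hε, hεu⟩ := Metric.mem_uniformity_dist.1 hu
    have hclose := Metric.tendstoUniformlyOn_iff.1 hF (ε * r / 16) (by positivity)
    filter_upwards [(hclose.and hd).prod_mk (hclose.and hd)]
    rintro ⟨i, j⟩ ⟨⟨hi, hdi⟩, hj, hdj⟩ z hz
    have hzr : ball z (r / 2) ∈ 𝓝 z := ball_mem_nhds z (by positivity)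
    have hdiff := norm_fderiv_le_of_norm_le (M := ε * r / 8) (half_pos hr)
      ((hdi.sub hdj).mono (hsub z hz)) fun w hw => by
        rw [Pi.sub_apply, ← dist_eq_norm]
        linarith [dist_triangle_left (F i w) (F j w) (f w), hi w (hsub z hz hw),
          hj w (hsub z hz hw)]
    rw [fderiv_sub ((hdi.mono (hsub z hz)).differentiableAt hzr)
      ((hdj.mono (hsub z hz)).differentiableAt hzr), ← dist_eq_norm] at hdiff
    refine hεu (hdiff.trans_lt ?_)
    rw [show 2 * (ε * r / 8) / (r / 2) = ε / 2 by field_simp; norm_num]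
    exact half_lt_self hε
  obtain ⟨L, hL⟩ : ∃ L : E → E →L[ℂ] G, ∀ z ∈ ball c (r / 2),
      Tendsto (fun i => fderiv ℂ (F i) z) φ (𝓝 (L z)) := by
    choose! L hL using fun z (hz : z ∈ ball c (r / 2)) =>
      CompleteSpace.complete (hcauchy.cauchy_map hz)
    exact ⟨L, hL⟩
  have hballs : ball c (r / 2) ∈ 𝓝 c := ball_mem_nhds c (half_pos hr)
  have hderiv := (hcauchy.tendstoUniformlyOn_of_tendsto hL).tendstoUniformlyOnFilter
  refine (hasFDerivAt_of_tendstoUniformlyOnFilter (f := F)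
    (hderiv.mono_right (le_principal_iff.2 hballs)) ?_ ?_).differentiableAt
  · filter_upwards [hd.prod_mk hballs]
    rintro ⟨i, z⟩ ⟨hi, hz⟩
    exact (hi.differentiableAt (isOpen_ball.mem_nhds
      (ball_subset_ball (half_le_self hr.le) hz))).hasFDerivAt
  · filter_upwards [ball_mem_nhds c hr] with z hz using hF.tendsto_at hz

theorem tendstoUniformlyOn_slope {X : Type*} {f : X → E → G} {c : X → E} {s : Set X} {r M : ℝ}
    (hr : 0 < r) (hd : ∀ x ∈ s, DifferentiableOn ℂ (f x) (ball (c x) r))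
    (hM : ∀ x ∈ s, ∀ z ∈ ball (c x) r, ‖f x z‖ ≤ M) (v : E) :
    TendstoUniformlyOn (fun (t : ℂ) x => t⁻¹ • (f x (c x + t • v) - f x (c x)))
      (fun x => fderiv ℂ (f x) (c x) v) (𝓝[≠] 0) s := by
  have hv : Tendsto (fun t : ℂ => ‖t • v‖) (𝓝[≠] 0) (𝓝 0) :=
    ((by fun_prop : Continuous fun t : ℂ => ‖t • v‖).tendsto' 0 0 (by simp)).mono_left
      nhdsWithin_le_nhds
  have hbound : Tendsto (fun t : ℂ => 4 * M * (‖v‖ / r) ^ 2 * ‖t‖) (𝓝[≠] 0) (𝓝 0) :=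
    ((by fun_prop : Continuous fun t : ℂ => 4 * M * (‖v‖ / r) ^ 2 * ‖t‖).tendsto' 0 0
      (by simp)).mono_left nhdsWithin_le_nhds
  rw [Metric.tendstoUniformlyOn_iff]
  intro ε hε
  filter_upwards [hv.eventually (gt_mem_nhds hr), hbound.eventually (gt_mem_nhds hε),
    self_mem_nhdsWithin] with t htr htε ht x hx
  have ht₀ : t ≠ 0 := ht
  have herror := norm_sub_sub_fderiv_le hr (hd x hx) (hM x hx)
    (z := c x + t • v) (by simpa [dist_eq_norm] using htr)
  rw [add_sub_cancel_left, map_smul] at herror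
  calc dist (fderiv ℂ (f x) (c x) v) (t⁻¹ • (f x (c x + t • v) - f x (c x)))
      = ‖t‖⁻¹ * ‖f x (c x + t • v) - f x (c x) - t • fderiv ℂ (f x) (c x) v‖ := by
        rw [dist_comm, dist_eq_norm, ← norm_inv, ← norm_smul, smul_sub t⁻¹ (_ - _), smul_smul,
          inv_mul_cancel₀ ht₀, one_smul]
    _ ≤ ‖t‖⁻¹ * (4 * M * (‖t • v‖ / r) ^ 2) := by gcongr
    _ = 4 * M * (‖v‖ / r) ^ 2 * ‖t‖ := by
        have := norm_ne_zero_iff.2 ht₀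
        rw [norm_smul]; field_simp
    _ < ε := htε

theorem differentiableOn_fderiv_apply [CompleteSpace G] {f : E → G} {s : Set E} (hs : IsOpen s)
    (hf : DifferentiableOn ℂ f s) (v : E) : DifferentiableOn ℂ (fun z => fderiv ℂ f z v) s := by
  intro c hc
  obtain ⟨R, hR, hRs⟩ := Metric.isOpen_iff.1 hs c hc
  obtain ⟨ρ, hρ, M, hM⟩ :=
    exists_norm_le_on_ball (hf.differentiableAt (hs.mem_nhds hc)).continuousAt
  obtain ⟨r, hr, hrR, hrρ⟩ : ∃ r > 0, 2 * r ≤ R ∧ 2 * r ≤ ρ :=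
    ⟨min R ρ / 2, by positivity, by linarith [min_le_left R ρ], by linarith [min_le_right R ρ]⟩
  have hsub : ∀ z ∈ ball c r, ball z r ⊆ ball c (2 * r) := fun z hz =>
    ball_subset_ball' (by linarith [mem_ball.1 hz])
  have hd : DifferentiableOn ℂ f (ball c (2 * r)) := hf.mono ((ball_subset_ball hrR).trans hRs)
  have hunif := tendstoUniformlyOn_slope (f := fun _ : E => f) (c := id) hr
    (fun z hz => hd.mono (hsub z hz))
    (fun z hz w hw => hM w (ball_subset_ball hrρ (hsub z hz hw))) v
  refine (differentiableAt_of_tendstoUniformlyOn_ball hr hunif ?_).differentiableWithinAt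
  have hsmall : ∀ᶠ t : ℂ in 𝓝[≠] 0, ‖t • v‖ < r := nhdsWithin_le_nhds <|
    ((by fun_prop : Continuous fun t : ℂ => ‖t • v‖).tendsto' 0 0 (by simp)).eventually
      (gt_mem_nhds hr)
  filter_upwards [hsmall] with t ht
  refine ((hd.comp (by fun_prop) fun z hz => hsub z hz ?_).sub
    (hd.mono (ball_subset_ball (by linarith)))).const_smul _
  simpa [dist_eq_norm] using ht

/-- Hartogs' theorem under a boundedness assumption, on the diagonal of `ℂ²`. -/
theorem differentiableAt_diag {φ : ℂ → ℂ → ℂ} {c : ℂ} {r M : ℝ} (hr : 0 < r)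
    (h₁ : ∀ t ∈ ball c r, DifferentiableOn ℂ (fun s => φ s t) (ball c r))
    (h₂ : ∀ s ∈ ball c r, DifferentiableOn ℂ (fun t => φ s t) (ball c r))
    (hM : ∀ s ∈ ball c r, ∀ t ∈ ball c r, ‖φ s t‖ ≤ M) :
    DifferentiableAt ℂ (fun s => φ s s) c := by
  set d : ℂ → ℂ := fun t => fderiv ℂ (fun s => φ s t) c 1
  have hd : DifferentiableAt ℂ d c := by
    refine differentiableAt_of_tendstoUniformlyOn_ball hr (tendstoUniformlyOn_slope
      (f := fun t s => φ s t) (c := fun _ => c) hr h₁ (fun t ht s hs => hM s hs t ht) 1) ?_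
    filter_upwards [nhdsWithin_le_nhds (ball_mem_nhds (0 : ℂ) hr)] with h hh
    exact ((h₂ (c + h • 1) (by simpa [dist_eq_norm] using hh)).sub
      (h₂ c (mem_ball_self hr))).const_smul (h⁻¹ : ℂ)
  -- Expanding in the first variable, `φ s s = φ c s + (s - c) d s + O(|s - c|²)`.
  have herror : (fun s => φ s s - φ c s - (s - c) * d s) =O[𝓝 c] fun s => ‖s - c‖ ^ 2 := by
    refine Asymptotics.IsBigO.of_bound (4 * M / r ^ 2) ?_
    filter_upwards [ball_mem_nhds c hr] with s hs
    have h := norm_sub_sub_fderiv_le hr (h₁ s hs) (fun u hu => hM u hu s hs) hs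
    rw [show fderiv ℂ (fun s' => φ s' s) c (s - c) = (s - c) * d s by
      rw [← smul_eq_mul, ← map_smul, smul_eq_mul, mul_one]] at h
    rw [norm_pow, norm_norm]
    exact h.trans_eq (by ring)
  have hφc := (h₂ c (mem_ball_self hr)).differentiableAt (ball_mem_nhds c hr)
  refine ((((herror.hasFDerivAt one_lt_two).differentiableAt.add hφc).add
    ((differentiableAt_id.sub_const c).mul hd))).congr_of_eventuallyEq (.of_forall fun s => ?_)
  simp only [Pi.add_apply, Pi.mul_apply, id_eq]
  ring

variable [CompleteSpace G]

theorem eqOn_zero_of_convex {f : E → G} {s : Set E} (hs : IsOpen s) (hc : Convex ℝ s)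
    (hf : DifferentiableOn ℂ f s) {a : E} (ha : a ∈ s) (hfa : f =ᶠ[𝓝 a] 0) : EqOn f 0 s := by
  intro z hz
  -- Restrict `f` to the complex line through `a` and `z`.
  have hline : Continuous fun t : ℂ => a + t • (z - a) := by fun_prop
  have hTc : Convex ℝ ((fun t : ℂ => a + t • (z - a)) ⁻¹' s) :=
    (hc.translate_preimage_right a).linear_preimage
      ((LinearMap.toSpanSingleton ℂ E (z - a)).restrictScalars ℝ)
  have hd : DifferentiableOn ℂ (fun t : ℂ => f (a + t • (z - a))) _ :=
    hf.comp (by fun_prop) (mapsTo_preimage _ s)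
  have h := (hd.analyticOnNhd (hs.preimage hline)).eqOn_zero_of_preconnected_of_eventuallyEq_zero
    hTc.isPreconnected (z₀ := 0) (by simpa using ha)
    ((hline.tendsto' 0 a (by simp)).eventually hfa) (show (1 : ℂ) ∈ _ by simpa using hz)
  simpa using h

theorem eqOn_zero_of_preconnected_of_eventuallyEq_zero {f : E → G} {s : Set E} (hs : IsOpen s)
    (hc : IsPreconnected s) (hf : DifferentiableOn ℂ f s) {a : E} (ha : a ∈ s)
    (hfa : f =ᶠ[𝓝 a] 0) : EqOn f 0 s := by
  suffices hsub : s ⊆ {z | f =ᶠ[𝓝 z] 0} from fun z hz => (hsub hz).self_of_nhds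
  refine hc.subset_of_closure_inter_subset isOpen_setOfPred_eventually_nhds ⟨a, ha, hfa⟩ ?_
  rintro b ⟨hb, hbs⟩
  obtain ⟨r, hr, hrs⟩ := Metric.isOpen_iff.1 hs b hbs
  obtain ⟨a', ha', hba'⟩ := Metric.mem_closure_iff.1 hb r hr
  exact (eqOn_zero_of_convex isOpen_ball (convex_ball b r) (hf.mono hrs)
    (mem_ball'.2 hba') ha').eventuallyEq_of_mem (ball_mem_nhds b hr)

end SeveralVariables

section ZeroSet

variable {E G : Type*} [NormedAddCommGroup E] [NormedSpace ℂ E] [FiniteDimensional ℂ E]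
  [MeasurableSpace E] [BorelSpace E] (μ : Measure E) [μ.IsAddHaarMeasure]
  [NormedAddCommGroup G] [NormedSpace ℂ G] [CompleteSpace G] {f : E → G}

/-- On almost every complex line through `a` the zeros of `f` are isolated; exchange the roles of
the direction `v` and the parameter `t`. -/
theorem ae_ae_add_smul_ne_zero {a : E} {r : ℝ} (hf : DifferentiableOn ℂ f (ball a r))
    (ha : f a ≠ 0) :
    ∀ᵐ t : ℂ, ∀ᵐ v ∂μ, t ∈ ball 0 1 → v ∈ ball 0 r → f (a + t • v) ≠ 0 := by
  have hmem : ∀ t ∈ ball (0 : ℂ) 1, ∀ v ∈ ball (0 : E) r, a + t • v ∈ ball a r := by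
    intro t ht v hv
    rw [mem_ball_zero_iff] at ht hv
    rw [mem_ball_iff_norm, add_sub_cancel_left, norm_smul]
    exact (mul_le_of_le_one_left (norm_nonneg v) ht.le).trans_lt hv
  have hprod : MeasurableSet (ball (0 : ℂ) 1 ×ˢ ball (0 : E) r) :=
    measurableSet_ball.prod measurableSet_ball
  have hmeas : MeasurableSet {q : ℂ × E | q.1 ∈ ball 0 1 → q.2 ∈ ball 0 r →
      f (a + q.1 • q.2) ≠ 0} := by
    have hcont : ContinuousOn (fun q : ℂ × E => f (a + q.1 • q.2))
        (ball (0 : ℂ) 1 ×ˢ ball (0 : E) r) :=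
      hf.continuousOn.comp (by fun_prop) fun q hq => hmem q.1 hq.1 q.2 hq.2
    have hopen := hcont.isOpen_inter_preimage (isOpen_ball.prod isOpen_ball)
      (isOpen_compl_singleton (x := (0 : G)))
    refine (hprod.compl.union hopen.measurableSet).congr (ext fun q => ?_)
    simp only [mem_union, mem_compl_iff, mem_prod, mem_inter_iff, mem_preimage,
      mem_singleton_iff, mem_ofPred_eq]
    tauto
  refine (Measure.ae_ae_comm hmeas).2 (.of_forall fun v => ?_)
  by_cases hv : v ∈ ball 0 r
  · have hd : DifferentiableOn ℂ (fun t : ℂ => f (a + t • v)) (ball 0 1) :=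
      hf.comp (by fun_prop) fun t ht => hmem t ht v hv
    filter_upwards [(ae_restrict_iff' measurableSet_ball).1
      (ae_restrict_le_codiscreteWithin measurableSet_ball
        ((hd.analyticOnNhd isOpen_ball).preimage_zero_mem_codiscreteWithin (x := 0)
          (by simpa using ha) (mem_ball_self one_pos)
          ((convex_ball _ _).isConnected ⟨0, mem_ball_self one_pos⟩)))] with t ht htb _
      using ht htb
  · exact .of_forall fun t _ h => (hv h).elim

theorem measure_ball_zeros_eq_zero {a : E} {r : ℝ} (hf : DifferentiableOn ℂ f (ball a r))
    (ha : f a ≠ 0) : μ (ball a (r / 2) ∩ f ⁻¹' {0}) = 0 := by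
  obtain ⟨t, ⟨ht, htnull⟩⟩ : ∃ t : ℂ, t ∈ ball 0 1 ∩ {t | 1 / 2 < ‖t‖} ∧ ∀ᵐ v ∂μ,
      t ∈ ball 0 1 → v ∈ ball 0 r → f (a + t • v) ≠ 0 := by
    have hpos : volume (ball (0 : ℂ) 1 ∩ {t | 1 / 2 < ‖t‖}) ≠ 0 :=
      ((isOpen_ball.inter (isOpen_lt continuous_const continuous_norm)).measure_pos _
        ⟨3 / 4, by simp; norm_num⟩).ne'
    exact ((frequently_ae_mem_iff.2 hpos).and_eventually (ae_ae_add_smul_ne_zero μ hf ha)).exists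
  have ht₀ : t ≠ 0 := norm_pos_iff.1 (one_half_pos.trans ht.2)
  refine measure_mono_null (fun z hz => ?_)
    (addHaar_image_eq_zero_of_differentiableOn_of_addHaar_eq_zero
    μ (f := fun v => a + t • v) (by fun_prop) htnull)
  refine ⟨t⁻¹ • (z - a), fun h => ?_, by simp [ht₀]⟩
  have hv : t⁻¹ • (z - a) ∈ ball (0 : E) r := by
    rw [mem_ball_zero_iff, norm_smul, norm_inv, inv_mul_lt_iff₀ (norm_pos_iff.2 ht₀)]
    have hza : ‖z - a‖ < r / 2 := mem_ball_iff_norm.1 hz.1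
    nlinarith [show 1 / 2 < ‖t‖ from ht.2, norm_nonneg (z - a)]
  exact h ht.1 hv (by simpa [ht₀] using hz.2)

theorem measure_zeros_eq_zero {s : Set E} (hs : IsOpen s) (hc : IsPreconnected s)
    (hf : DifferentiableOn ℂ f s) {a : E} (ha : a ∈ s) (hfa : f a ≠ 0) :
    μ (s ∩ f ⁻¹' {0}) = 0 := by
  refine measure_null_of_locally_null _ fun b hb => ?_
  obtain ⟨r, hr, hrs⟩ := Metric.isOpen_iff.1 hs b hb.1
  obtain ⟨c, hcr, hfc⟩ : ∃ c ∈ ball b (r / 4), f c ≠ 0 := by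
    by_contra! h
    exact hfa (eqOn_zero_of_preconnected_of_eventuallyEq_zero hs hc hf hb.1
      (eventually_of_mem (ball_mem_nhds b (by positivity)) h) ha)
  have hcb : dist c b < r / 4 := hcr
  have hnull := measure_ball_zeros_eq_zero μ (r := 3 * r / 4)
    (hf.mono ((ball_subset_ball' (by linarith)).trans hrs)) hfc
  refine ⟨s ∩ f ⁻¹' {0} ∩ ball b (r / 8),
    inter_mem_nhdsWithin _ (ball_mem_nhds b (by positivity)), measure_mono_null ?_ hnull⟩
  rintro z ⟨⟨-, hz⟩, hzb⟩
  refine ⟨ball_subset_ball' ?_ hzb, hz⟩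
  rw [dist_comm]
  linarith

end ZeroSet

/-! ### Polarization -/

section Polarization

variable {E : Type*} [NormedAddCommGroup E] [NormedSpace ℂ E]

/-- Functions of two variables that are holomorphic in the first variable and antiholomorphic in
the second one, such as reproducing kernels. Holomorphy is only required separately in each
variable. -/
structure IsSesquiholomorphicOn (h : E → E → ℂ) (s : Set E) : Prop where
  left : ∀ w ∈ s, DifferentiableOn ℂ (fun z => h z w) s
  right : ∀ z ∈ s, DifferentiableOn ℂ (fun w => conj (h z w)) s

theorem IsSesquiholomorphicOn.mono {h : E → E → ℂ} {s t : Set E}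
    (hh : IsSesquiholomorphicOn h t) (hst : s ⊆ t) : IsSesquiholomorphicOn h s :=
  ⟨fun w hw => (hh.left w (hst hw)).mono hst, fun z hz => (hh.right z (hst hz)).mono hst⟩

theorem IsSesquiholomorphicOn.differentiableOn_conj_line {h : E → E → ℂ} {s : Set E}
    (hh : IsSesquiholomorphicOn h s) (hs : IsOpen s) {M : ℝ}
    (hM : ∀ z ∈ s, ∀ w ∈ s, ‖h z w‖ ≤ M) {c v : E} {U : Set ℂ} (hU : IsOpen U)
    (hmem : ∀ t ∈ U, c + t • v ∈ s) (hconj : ∀ t ∈ U, conj t ∈ U) :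
    DifferentiableOn ℂ (fun t => h (c + t • v) (c + conj t • v)) U := by
  intro t₀ ht₀
  obtain ⟨r, hr, hrU⟩ := Metric.isOpen_iff.1 hU t₀ ht₀
  refine (differentiableAt_diag (φ := fun t u => h (c + t • v) (c + conj u • v)) hr (M := M)
    ?_ ?_ ?_).differentiableWithinAt
  · exact fun u hu => (hh.left _ (hmem _ (hconj u (hrU hu)))).comp (by fun_prop)
      fun t ht => hmem t (hrU ht)
  · intro t ht u hu
    have hright := (hh.right _ (hmem t (hrU ht))).differentiableAt
      (hs.mem_nhds (hmem _ (hconj u (hrU hu))))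
    have hline : DifferentiableAt ℂ (fun u : ℂ => conj (h (c + t • v) (c + u • v))) (conj u) :=
      hright.comp (conj u) (f := fun u : ℂ => c + u • v) (by fun_prop)
    simpa [Function.comp_def] using hline.conj_conj.differentiableWithinAt (s := ball t₀ r)
  · exact fun t ht u hu => hM _ (hmem t (hrU ht)) _ (hmem _ (hconj u (hrU hu)))

theorem eqOn_zero_of_forall_ofReal {g : ℂ → ℂ} {r : ℝ} (hr : 0 < r)
    (hg : DifferentiableOn ℂ g (ball 0 r)) (hreal : ∀ x : ℝ, |x| < r → g x = 0) :
    EqOn g 0 (ball 0 r) := by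
  have hfreq : ∃ᶠ x : ℝ in 𝓝[≠] 0, g x = 0 := by
    refine Eventually.frequently ?_
    filter_upwards [nhdsWithin_le_nhds (ball_mem_nhds (0 : ℝ) hr)] with x hx
    exact hreal x (by simpa using hx)
  have htendsto : Tendsto (fun x : ℝ => (x : ℂ)) (𝓝[≠] 0) (𝓝[≠] 0) :=
    (Complex.continuous_ofReal.tendsto' 0 0 Complex.ofReal_zero).inf
      (tendsto_principal_principal.2 fun x hx => by simpa using hx)
  exact (hg.analyticOnNhd isOpen_ball).eqOn_zero_of_preconnected_of_frequently_eq_zero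
    (convex_ball _ _).isPreconnected (mem_ball_self hr) (htendsto.frequently hfreq)

theorem IsSesquiholomorphicOn.apply_center_eq_zero {h : E → E → ℂ} {a : E} {r M : ℝ}
    (hh : IsSesquiholomorphicOn h (ball a r)) (hM : ∀ z ∈ ball a r, ∀ w ∈ ball a r, ‖h z w‖ ≤ M)
    (hdiag : ∀ z ∈ ball a r, h z z = 0) {z : E} (hz : z ∈ ball a (r / 4)) : h z a = 0 := by
  -- With `c` the midpoint of `a` and `z`, the points `c ± I • v` are `z` and `a`, while for real
  -- `t` the point `(c + t • v, c + conj t • v)` lies on the diagonal.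
  set c : E := a + (1 / 2 : ℂ) • (z - a) with hc
  set v : E := (-Complex.I / 2) • (z - a) with hv
  have hmem : ∀ t ∈ ball (0 : ℂ) 2, c + t • v ∈ ball a r := by
    intro t ht
    rw [mem_ball_zero_iff] at ht
    rw [mem_ball_iff_norm] at hz ⊢
    have hcoeff : ‖1 / 2 + t * (-Complex.I / 2)‖ ≤ 2 := by
      refine (norm_add_le _ _).trans ?_
      simp only [norm_div, norm_mul, norm_neg, Complex.norm_I, norm_one, RCLike.norm_ofNat]
      linarith
    calc ‖c + t • v - a‖ = ‖(1 / 2 + t * (-Complex.I / 2)) • (z - a)‖ := by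
          rw [hc, hv, smul_smul, add_smul, add_assoc, add_sub_cancel_left]
      _ ≤ 2 * ‖z - a‖ := by rw [norm_smul]; gcongr
      _ < r := by linarith [norm_nonneg (z - a)]
  have hzero := eqOn_zero_of_forall_ofReal two_pos
    (hh.differentiableOn_conj_line isOpen_ball hM isOpen_ball hmem fun t ht => by simpa using ht)
    (fun x hx => by
      rw [Complex.conj_ofReal]
      exact hdiag _ (hmem _ (by simpa using hx)))
    (show Complex.I ∈ ball (0 : ℂ) 2 by simp)
  have hzI : c + Complex.I • v = z := by
    rw [hc, hv, smul_smul, add_assoc, ← add_smul,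
      show (1 / 2 : ℂ) + Complex.I * (-Complex.I / 2) = 1 by
        linear_combination (-1 / 2) * Complex.I_mul_I, one_smul, add_sub_cancel]
  have haI : c + conj Complex.I • v = a := by
    rw [hc, hv, smul_smul, add_assoc, ← add_smul, Complex.conj_I,
      show (1 / 2 : ℂ) + -Complex.I * (-Complex.I / 2) = 0 by
        linear_combination (1 / 2) * Complex.I_mul_I, zero_smul, add_zero]
  simpa only [hzI, haI, Pi.zero_apply] using hzero

theorem IsSesquiholomorphicOn.eq_zero_of_diag_eq_zero {h : E → E → ℂ} {s : Set E}
    (hh : IsSesquiholomorphicOn h s) (hs : IsOpen s) (hc : IsPreconnected s)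
    (hb : ∀ a ∈ s, ∃ U ∈ 𝓝 a, ∃ M, ∀ z ∈ U, ∀ w ∈ U, ‖h z w‖ ≤ M)
    (hdiag : ∀ z ∈ s, h z z = 0) {z w : E} (hz : z ∈ s) (hw : w ∈ s) : h z w = 0 := by
  refine eqOn_zero_of_preconnected_of_eventuallyEq_zero hs hc (hh.left w hw) hw ?_ hz
  obtain ⟨U, hU, M, hM⟩ := hb w hw
  obtain ⟨r, hr, hrU⟩ := Metric.mem_nhds_iff.1 (inter_mem hU (hs.mem_nhds hw))
  filter_upwards [ball_mem_nhds w (show 0 < r / 4 by positivity)] with y hy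
  exact (hh.mono (hrU.trans inter_subset_right)).apply_center_eq_zero
    (fun z hz w hw => hM z (hrU hz).1 w (hrU hw).1) (fun z hz => hdiag z (hrU hz).2) hy

end Polarization

/-! ### The mean value inequality -/

section MeanValue

variable {ι : Type*} [Fintype ι]

theorem measurePreserving_circle_smul {e : ℂ} (he : ‖e‖ = 1) :
    MeasurePreserving (fun v : ι → ℂ => e • v) :=
  volume_preserving_pi (f := fun _ : ι => fun z : ℂ => e * z) fun _ =>
    (rotation ⟨e, by simpa [Submonoid.unitSphere] using he⟩).measurePreserving

theorem lintegral_circleAverage_smul {u : (ι → ℂ) → ℝ≥0∞} (hu : Measurable u) :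
    ∫⁻ v, ENNReal.ofReal (2 * Real.pi)⁻¹ *
      ∫⁻ θ in Ioc 0 (2 * Real.pi), u (circleMap 0 1 θ • v) = ∫⁻ v, u v := by
  have hmeas : Measurable fun q : (ι → ℂ) × ℝ => u (circleMap 0 1 q.2 • q.1) := by
    have := continuous_circleMap 0 1
    exact hu.comp (by fun_prop)
  rw [lintegral_const_mul' _ _ ENNReal.ofReal_ne_top,
    lintegral_lintegral_swap hmeas.aemeasurable]
  have hrotate (θ : ℝ) : ∫⁻ v, u (circleMap 0 1 θ • v) = ∫⁻ v, u v :=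
    (measurePreserving_circle_smul (by simp)).lintegral_comp hu
  simp only [hrotate]
  rw [setLIntegral_const, Real.volume_Ioc, sub_zero, mul_left_comm,
    ← ENNReal.ofReal_mul (by positivity), inv_mul_cancel₀ (by positivity), ENNReal.ofReal_one,
    mul_one]

theorem enorm_sq_le_circleAverage {f : ℂ → ℂ} (hf : DifferentiableOn ℂ f (closedBall 0 1)) :
    ‖f 0‖ₑ ^ 2 ≤ ENNReal.ofReal (2 * Real.pi)⁻¹ *
      ∫⁻ θ in Ioc 0 (2 * Real.pi), ‖f (circleMap 0 1 θ)‖ₑ ^ 2 := by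
  have hmean : Real.circleAverage (fun t => f t ^ 2) 0 1 = f 0 ^ 2 :=
    DiffContOnCl.circleAverage ((hf.pow 2).diffContOnCl_ball (by rw [abs_one]))
  rw [← enorm_pow, ← hmean, Real.circleAverage_def, enorm_smul,
    intervalIntegral.integral_of_le Real.two_pi_pos.le, Real.enorm_eq_ofReal (by positivity)]
  gcongr
  exact (enorm_integral_le_lintegral_enorm _).trans_eq (by simp only [enorm_pow])

theorem volume_mul_enorm_sq_le {f : (ι → ℂ) → ℂ} {c : ι → ℂ} {r : ℝ}
    (hf : DifferentiableOn ℂ f (ball c r)) :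
    volume (ball (0 : ι → ℂ) r) * ‖f c‖ₑ ^ 2 ≤ ∫⁻ z in ball c r, ‖f z‖ₑ ^ 2 := by
  set u : (ι → ℂ) → ℝ≥0∞ := (ball 0 r).indicator fun v => ‖f (c + v)‖ₑ ^ 2 with hu
  have hmem : ∀ v ∈ ball (0 : ι → ℂ) r, c + v ∈ ball c r := fun v hv => by simpa using hv
  have hum : Measurable u := by
    classical
    have hcont : ContinuousOn (fun v => ‖f (c + v)‖ₑ ^ 2) (ball (0 : ι → ℂ) r) :=
      (ENNReal.continuous_pow 2).comp_continuousOn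
        (hf.continuousOn.comp (by fun_prop) hmem).enorm
    rw [hu, ← piecewise_eq_indicator]
    exact hcont.measurable_piecewise continuousOn_const measurableSet_ball
  have hcircle : ∀ v ∈ ball (0 : ι → ℂ) r, ‖f c‖ₑ ^ 2 ≤
      ENNReal.ofReal (2 * Real.pi)⁻¹ *
        ∫⁻ θ in Ioc 0 (2 * Real.pi), u (circleMap 0 1 θ • v) := by
    intro v hv
    have hdisc : ∀ t ∈ closedBall (0 : ℂ) 1, t • v ∈ ball (0 : ι → ℂ) r := by
      intro t ht
      rw [mem_closedBall_zero_iff] at ht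
      rw [mem_ball_zero_iff] at hv ⊢
      exact (norm_smul_le t v).trans_lt ((mul_le_of_le_one_left (norm_nonneg v) ht).trans_lt hv)
    have hline := enorm_sq_le_circleAverage (f := fun t => f (c + t • v))
      (hf.comp (by fun_prop) fun t ht => hmem _ (hdisc t ht))
    simpa only [zero_smul, add_zero, hu, indicator_of_mem (hdisc _ (circleMap_mem_closedBall 0
      zero_le_one _))] using hline
  calc volume (ball (0 : ι → ℂ) r) * ‖f c‖ₑ ^ 2
      = ∫⁻ _ in ball (0 : ι → ℂ) r, ‖f c‖ₑ ^ 2 := by rw [setLIntegral_const, mul_comm]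
    _ ≤ _ := (setLIntegral_mono' measurableSet_ball hcircle).trans
      (setLIntegral_le_lintegral _ _)
    _ = ∫⁻ v, u v := lintegral_circleAverage_smul hum
    _ = ∫⁻ v, (ball c r).indicator (fun z => ‖f z‖ₑ ^ 2) (c + v) := by
      simp only [hu, indicator, mem_ball, dist_self_add_left, dist_zero_right]
    _ = ∫⁻ z in ball c r, ‖f z‖ₑ ^ 2 := by
      rw [lintegral_add_left_eq_self ((ball c r).indicator fun z => ‖f z‖ₑ ^ 2) c,
        lintegral_indicator measurableSet_ball]

end MeanValue

/-! ### Holomorphic functions on a domain -/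

section Domain

variable {n : ℕ} {D : Set (Fin n → ℂ)} {F : Type*} [NormedAddCommGroup F] [NormedSpace ℂ F]

theorem isHolomorphic_const (a : F) : IsHolomorphic fun _ : D => a :=
  isHolomorphic_of_eqOn (differentiableOn_const a) fun _ => rfl

theorem IsHolomorphic.sub {f g : D → F} (hf : IsHolomorphic f) (hg : IsHolomorphic g) :
    IsHolomorphic fun z => f z - g z :=
  isHolomorphic_of_eqOn (DifferentiableOn.sub hf hg) fun z => by
    simp only [Pi.sub_apply, extend_coe]

theorem IsHolomorphic.add {f g : D → F} (hf : IsHolomorphic f) (hg : IsHolomorphic g) :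
    IsHolomorphic fun z => f z + g z :=
  isHolomorphic_of_eqOn (DifferentiableOn.add hf hg) fun z => by
    simp only [Pi.add_apply, extend_coe]

theorem IsHolomorphic.const_smul {f : D → F} (hf : IsHolomorphic f) (a : ℂ) :
    IsHolomorphic fun z => a • f z :=
  isHolomorphic_of_eqOn (DifferentiableOn.const_smul hf a) fun z => by
    simp only [Pi.smul_apply, extend_coe]

theorem IsHolomorphic.mul {f g : D → ℂ} (hf : IsHolomorphic f) (hg : IsHolomorphic g) :
    IsHolomorphic fun z => f z * g z :=
  isHolomorphic_of_eqOn (DifferentiableOn.mul hf hg) fun z => by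
    simp only [Pi.mul_apply, extend_coe]

theorem IsHolomorphic.pow {f : D → ℂ} (hf : IsHolomorphic f) (k : ℕ) :
    IsHolomorphic fun z => f z ^ k :=
  isHolomorphic_of_eqOn (DifferentiableOn.pow hf k) fun z => by
    simp only [Pi.pow_apply, extend_coe]

theorem isHolomorphic_pi {m : ℕ} {f : D → Fin m → ℂ} :
    IsHolomorphic f ↔ ∀ i, IsHolomorphic fun z => f z i := by
  refine ⟨fun hf i => isHolomorphic_of_eqOn (differentiableOn_pi.1 hf i) fun z => ?_,
    fun hf => isHolomorphic_of_eqOn (differentiableOn_pi.2 hf) fun z => funext fun i => ?_⟩ <;>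
  rw [extend_coe]

theorem IsHolomorphic.differentiableAt {f : D → F} (hf : IsHolomorphic f) (hD : IsOpen D)
    (z : D) : DifferentiableAt ℂ (Function.extend Subtype.val f 0) z :=
  DifferentiableOn.differentiableAt hf (hD.mem_nhds z.2)

theorem isCompact_preimage_coe {X : Type*} [TopologicalSpace X] {s A : Set X}
    (hA : IsCompact A) (hAs : A ⊆ s) : IsCompact ((↑) ⁻¹' A : Set s) :=
  Topology.IsInducing.subtypeVal.isCompact_preimage' hA (by simpa using hAs)

theorem isHolomorphic_of_tendstoUniformlyOn [CompleteSpace F] (hD : IsOpen D) {ι : Type*}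
    {φ : Filter ι} [NeBot φ] {f : ι → D → F} {g : D → F} (hf : ∀ i, IsHolomorphic (f i))
    (hfg : ∀ A : Set D, IsCompact A → TendstoUniformlyOn f g φ A) : IsHolomorphic g := by
  intro c hc
  obtain ⟨r, hr, hrD⟩ := Metric.nhds_basis_closedBall.mem_iff.1 (hD.mem_nhds hc)
  refine (differentiableAt_of_tendstoUniformlyOn_ball hr (φ := φ)
    (F := fun i => Function.extend Subtype.val (f i) 0) ?_ (.of_forall fun i =>
      DifferentiableOn.mono (hf i) (ball_subset_closedBall.trans hrD))).differentiableWithinAt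
  have hunif := hfg _ (isCompact_preimage_coe (isCompact_closedBall c r) hrD)
  rw [Metric.tendstoUniformlyOn_iff] at hunif ⊢
  intro ε hε
  filter_upwards [hunif ε hε] with i hi z hz
  have hzD := hrD (ball_subset_closedBall hz)
  have hdist := hi ⟨z, hzD⟩ (ball_subset_closedBall hz)
  rwa [← extend_coe g, ← extend_coe (f i)] at hdist

theorem setLIntegral_preimage_coe_eucVolume (hD : IsOpen D) {f : D → F} {T : Set (Fin n → ℂ)}
    (hTD : T ⊆ D) (hT : MeasurableSet T) :
    ∫⁻ w in ((↑) ⁻¹' T : Set D), ‖f w‖ₑ ^ 2 ∂(eucVolume D) =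
      ∫⁻ w in T, ‖Function.extend Subtype.val f 0 w‖ₑ ^ 2 := by
  have hmap : Measure.map (↑) (eucVolume D) = volume.restrict D :=
    (MeasurableEmbedding.subtype_coe hD.measurableSet).map_comap _ |>.trans (by simp)
  have hrestrict : (volume.restrict D).restrict T = volume.restrict T := by
    rw [Measure.restrict_restrict hT, inter_eq_left.2 hTD]
  rw [← hrestrict, ← hmap, (MeasurableEmbedding.subtype_coe hD.measurableSet).restrict_map,
    (MeasurableEmbedding.subtype_coe hD.measurableSet).lintegral_map]
  simp only [extend_coe]

theorem exists_enorm_sq_le_setLIntegral (hD : IsOpen D) {A : Set D} (hA : IsCompact A) :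
    ∃ A' : Set D, IsCompact A' ∧ ∃ C : ℝ≥0, ∀ f : D → ℂ, IsHolomorphic f → ∀ z ∈ A,
      ‖f z‖ₑ ^ 2 ≤ C * ∫⁻ w in A', ‖f w‖ₑ ^ 2 ∂(eucVolume D) := by
  have hA₁ : IsCompact ((↑) '' A : Set (Fin n → ℂ)) := Subtype.isCompact_iff.1 hA
  obtain ⟨δ, hδ, hsub⟩ := hA₁.exists_cthickening_subset_open hD (Subtype.coe_image_subset D A)
  set T : Set (Fin n → ℂ) := cthickening δ ((↑) '' A)
  have hT : IsCompact T := hA₁.cthickening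
  lift volume (ball (0 : Fin n → ℂ) δ) to ℝ≥0 using measure_ball_lt_top.ne with v hv
  have hv₀ : v ≠ 0 := by
    rw [← ENNReal.coe_ne_zero, hv]
    exact (measure_ball_pos _ _ hδ).ne'
  refine ⟨_, isCompact_preimage_coe hT hsub, v⁻¹, fun f hf z hz => ?_⟩
  have hball : ball (z : Fin n → ℂ) δ ⊆ T :=
    ball_subset_closedBall.trans (closedBall_subset_cthickening (mem_image_of_mem _ hz) δ)
  have hmean := volume_mul_enorm_sq_le (DifferentiableOn.mono hf (hball.trans hsub))
  rw [extend_coe, ← hv] at hmean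
  rw [setLIntegral_preimage_coe_eucVolume hD hsub hT.measurableSet]
  calc ‖f z‖ₑ ^ 2 = (v⁻¹ : ℝ≥0) * (v * ‖f z‖ₑ ^ 2) := by
        rw [← mul_assoc, ← ENNReal.coe_mul, inv_mul_cancel₀ hv₀, ENNReal.coe_one, one_mul]
    _ ≤ _ := by gcongr; exact hmean.trans (lintegral_mono_set hball)

end Domain

/-! ### Weighted Bergman kernels -/

section Kernels

variable {n : ℕ} {D : Set (Fin n → ℂ)} {μ : Measure D}

/-- Point evaluations of holomorphic functions are bounded in the `L²(μ)` norm, locally uniformly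
in the point; this is what makes the holomorphic part of `L²(μ)` a reproducing kernel Hilbert
space. -/
def EvalBounded (μ : Measure D) : Prop :=
  ∀ A : Set D, IsCompact A → ∃ C : ℝ≥0, ∀ f : D → ℂ, IsHolomorphic f → ∀ z ∈ A,
    ‖f z‖ₑ ^ 2 ≤ C * ∫⁻ w, ‖f w‖ₑ ^ 2 ∂μ

/-- `K` is a Hermitian reproducing kernel of the space of `μ`-square integrable holomorphic
functions: a weighted analogue of `IsBergmanKernel`. -/
structure IsReproducingKernel (μ : Measure D) (K : D → D → ℂ) : Prop where
  holo : ∀ w : D, IsHolomorphic fun z => K z w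
  memLp : ∀ w : D, MemLp (fun z => K z w) 2 μ
  hermitian : ∀ z w : D, K z w = conj (K w z)
  reproducing : ∀ f : D → ℂ, IsHolomorphic f → MemLp f 2 μ → ∀ z : D,
    f z = ∫ w : D, f w * K z w ∂μ

theorem lintegral_enorm_sq_eq {X : Type*} [MeasurableSpace X] {ν : Measure X} (f : X → ℂ) :
    ∫⁻ w, ‖f w‖ₑ ^ 2 ∂ν = eLpNorm f 2 ν ^ 2 := by
  simpa using (eLpNorm_nnreal_pow_eq_lintegral (f := f) (μ := ν) (p := 2) two_ne_zero).symm

theorem EvalBounded.eq_of_ae_eq (hμ : EvalBounded μ) {f g : D → ℂ} (hf : IsHolomorphic f)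
    (hg : IsHolomorphic g) (hfg : f =ᵐ[μ] g) : f = g := by
  funext z
  obtain ⟨C, hC⟩ := hμ {z} isCompact_singleton
  have hzero : ∫⁻ w, ‖f w - g w‖ₑ ^ 2 ∂μ = 0 := by
    rw [lintegral_congr_ae (g := fun _ => 0), lintegral_zero]
    filter_upwards [hfg] with w hw
    simp [hw]
  simpa [hzero, sub_eq_zero] using hC _ (hf.sub hg) z rfl

/-- The Bergman space of `μ`: the classes in `L²(μ)` that have a holomorphic representative. -/
def bergmanSubmodule (μ : Measure D) : Submodule ℂ (Lp ℂ 2 μ) where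
  carrier := {F | ∃ f : D → ℂ, IsHolomorphic f ∧ F =ᵐ[μ] f}
  add_mem' := by
    rintro F G ⟨f, hf, hF⟩ ⟨g, hg, hG⟩
    exact ⟨fun z => f z + g z, hf.add hg, (Lp.coeFn_add F G).trans (hF.add hG)⟩
  zero_mem' := ⟨fun _ => 0, isHolomorphic_const 0, Lp.coeFn_zero ℂ 2 μ⟩
  smul_mem' := by
    rintro a F ⟨f, hf, hF⟩
    exact ⟨fun z => a • f z, hf.const_smul a, (Lp.coeFn_smul a F).trans (hF.const_smul a)⟩

theorem norm_sub_le_of_enorm_sq_le {C : ℝ≥0} {A : Set D}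
    (hC : ∀ f : D → ℂ, IsHolomorphic f → ∀ z ∈ A, ‖f z‖ₑ ^ 2 ≤ C * ∫⁻ w, ‖f w‖ₑ ^ 2 ∂μ)
    {F G : Lp ℂ 2 μ} {f g : D → ℂ} (hf : IsHolomorphic f) (hg : IsHolomorphic g)
    (hF : F =ᵐ[μ] f) (hG : G =ᵐ[μ] g) {z : D} (hz : z ∈ A) :
    ‖f z - g z‖ ≤ √C * ‖F - G‖ := by
  have hae : (fun w => f w - g w) =ᵐ[μ] (F - G : Lp ℂ 2 μ) :=
    (hF.sub hG).symm.trans (Lp.coeFn_sub F G).symm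
  have hle := hC _ (hf.sub hg) z hz
  rw [lintegral_enorm_sq_eq, eLpNorm_congr_ae hae, ← Lp.enorm_def] at hle
  have hsq : ‖f z - g z‖ ^ 2 ≤ C * ‖F - G‖ ^ 2 := by
    simpa using ENNReal.toReal_mono (by finiteness) hle
  refine le_of_sq_le_sq ?_ (by positivity)
  rwa [mul_pow, Real.sq_sqrt C.coe_nonneg]

theorem isClosed_bergmanSubmodule (hD : IsOpen D) (hμ : EvalBounded μ) :
    IsClosed (bergmanSubmodule μ : Set (Lp ℂ 2 μ)) := by
  refine IsSeqClosed.isClosed fun x F hx hxF => ?_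
  choose f hf hxf using hx
  have hcauchy : ∀ A : Set D, IsCompact A → UniformCauchySeqOn f atTop A := by
    intro A hA
    obtain ⟨C, hC⟩ := hμ A hA
    rw [Metric.uniformCauchySeqOn_iff]
    intro ε hε
    obtain ⟨N, hN⟩ := Metric.cauchySeq_iff.1 hxF.cauchySeq (ε / (√C + 1)) (by positivity)
    refine ⟨N, fun i hi j hj z hz => ?_⟩
    have hle := norm_sub_le_of_enorm_sq_le hC (hf i) (hf j) (hxf i) (hxf j) hz
    have hlt := hN i hi j hj
    rw [dist_eq_norm] at hlt ⊢
    rw [lt_div_iff₀ (by positivity)] at hlt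
    nlinarith [norm_nonneg (x i - x j)]
  choose g hg using fun z => cauchySeq_tendsto_of_complete
    ((hcauchy {z} isCompact_singleton).cauchySeq rfl)
  refine ⟨g, isHolomorphic_of_tendstoUniformlyOn hD hf fun A hA =>
    (hcauchy A hA).tendstoUniformlyOn_of_tendsto fun z _ => hg z, ?_⟩
  obtain ⟨ns, hns, hae⟩ := (tendstoInMeasure_of_tendsto_Lp hxF).exists_seq_tendsto_ae
  filter_upwards [hae, ae_all_iff.2 hxf] with z hz hxz
  simp only [hxz] at hz
  exact tendsto_nhds_unique hz ((hg z).comp hns.tendsto_atTop)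

/-- The holomorphic representative of an element of the Bergman space. It is unique when point
evaluations are bounded, see `bergmanRep_eq`. -/
noncomputable def bergmanRep (F : bergmanSubmodule μ) : D → ℂ := F.2.choose

theorem isHolomorphic_bergmanRep (F : bergmanSubmodule μ) : IsHolomorphic (bergmanRep F) :=
  F.2.choose_spec.1

theorem coeFn_ae_eq_bergmanRep (F : bergmanSubmodule μ) : F =ᵐ[μ] bergmanRep F :=
  F.2.choose_spec.2

theorem bergmanRep_eq (hμ : EvalBounded μ) {F : bergmanSubmodule μ} {f : D → ℂ}
    (hf : IsHolomorphic f) (hFf : F =ᵐ[μ] f) : bergmanRep F = f :=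
  hμ.eq_of_ae_eq (isHolomorphic_bergmanRep F) hf ((coeFn_ae_eq_bergmanRep F).symm.trans hFf)

/-- The reproducing kernel Hilbert space structure of the Bergman space of `μ`. -/
@[reducible]
noncomputable def bergmanRKHS (hμ : EvalBounded μ) : RKHS ℂ (bergmanSubmodule μ) D ℂ where
  coeCLM :=
    { toFun := bergmanRep
      map_add' := fun F G => bergmanRep_eq hμ
        ((isHolomorphic_bergmanRep F).add (isHolomorphic_bergmanRep G))
        ((Lp.coeFn_add _ _).trans ((coeFn_ae_eq_bergmanRep F).add (coeFn_ae_eq_bergmanRep G)))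
      map_smul' := fun a F => bergmanRep_eq hμ ((isHolomorphic_bergmanRep F).const_smul a)
        ((Lp.coeFn_smul _ _).trans ((coeFn_ae_eq_bergmanRep F).const_smul a))
      cont := by
        refine continuous_pi fun z => ?_
        obtain ⟨C, hC⟩ := hμ {z} isCompact_singleton
        refine (LipschitzWith.of_dist_le_mul (K := NNReal.sqrt C) fun F G => ?_).continuous
        rw [dist_eq_norm, Subtype.dist_eq, dist_eq_norm, Real.coe_sqrt]
        exact norm_sub_le_of_enorm_sq_le hC (isHolomorphic_bergmanRep F)
          (isHolomorphic_bergmanRep G) (coeFn_ae_eq_bergmanRep F) (coeFn_ae_eq_bergmanRep G) rfl }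
  coeCLM_injective := fun F G hFG => Subtype.ext <| Lp.ext <|
    (coeFn_ae_eq_bergmanRep F).trans <| (Eq.eventuallyEq hFG).trans
      (coeFn_ae_eq_bergmanRep G).symm

theorem exists_isReproducingKernel (hD : IsOpen D) (hμ : EvalBounded μ) :
    ∃ K : D → D → ℂ, IsReproducingKernel μ K := by
  have : CompleteSpace (bergmanSubmodule μ) :=
    (isClosed_bergmanSubmodule hD hμ).completeSpace_coe
  let := bergmanRKHS hμ
  set k : D → bergmanSubmodule μ := fun w => RKHS.kerFun (bergmanSubmodule μ) w 1
  have hinner : ∀ z F, inner ℂ (k z) F = bergmanRep F z := fun z F => by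
    rw [RKHS.kerFun_inner, RCLike.inner_apply, map_one, mul_one]
    rfl
  have hsymm : ∀ z w, bergmanRep (k w) z = conj (bergmanRep (k z) w) := fun z w => by
    rw [← hinner, ← hinner]
    exact (inner_conj_symm (k z) (k w)).symm
  refine ⟨fun z w => bergmanRep (k w) z, fun w => isHolomorphic_bergmanRep _,
    fun w => (memLp_congr_ae (coeFn_ae_eq_bergmanRep (k w))).1 (Lp.memLp _), hsymm,
    fun f hf hfL z => ?_⟩
  have hmem : hfL.toLp f ∈ bergmanSubmodule μ := ⟨f, hf, hfL.coeFn_toLp⟩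
  calc f z = inner ℂ (k z) ⟨_, hmem⟩ := by
        rw [hinner, bergmanRep_eq hμ (F := ⟨_, hmem⟩) hf hfL.coeFn_toLp]
    _ = ∫ w, f w * bergmanRep (k w) z ∂μ := by
      rw [Submodule.coe_inner, L2.inner_def]
      refine integral_congr_ae ?_
      filter_upwards [hfL.coeFn_toLp, coeFn_ae_eq_bergmanRep (k z)] with w hfw hkw
      rw [hfw, hkw, RCLike.inner_apply, hsymm z w]

variable {K : D → D → ℂ}

theorem IsReproducingKernel.unique {L : D → D → ℂ} (hK : IsReproducingKernel μ K)
    (hL : IsReproducingKernel μ L) : K = L := by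
  funext z w
  rw [hL.reproducing _ (hK.holo w) (hK.memLp w) z, hL.hermitian z w,
    hK.reproducing _ (hL.holo z) (hL.memLp z) w, ← integral_conj]
  refine integral_congr_ae (.of_forall fun u => ?_)
  simp only
  rw [map_mul, hL.hermitian z u, hK.hermitian u w, mul_comm]

theorem IsReproducingKernel.inner_toLp (hK : IsReproducingKernel μ K) (z w : D) :
    inner ℂ ((hK.memLp z).toLp _) ((hK.memLp w).toLp _) = K z w := by
  rw [L2.inner_def, hK.reproducing _ (hK.holo w) (hK.memLp w) z]
  refine integral_congr_ae ?_
  filter_upwards [(hK.memLp z).coeFn_toLp, (hK.memLp w).coeFn_toLp] with u hz hw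
  rw [hz, hw, RCLike.inner_apply, ← hK.hermitian z u]

theorem IsReproducingKernel.norm_sq_toLp (hK : IsReproducingKernel μ K) (z : D) :
    ((‖(hK.memLp z).toLp _‖ ^ 2 : ℝ) : ℂ) = K z z := by
  rw [← hK.inner_toLp, inner_self_eq_norm_sq_to_K]
  simp

theorem IsReproducingKernel.re_diag_nonneg (hK : IsReproducingKernel μ K) (z : D) :
    0 ≤ (K z z).re := by
  rw [← hK.norm_sq_toLp, Complex.ofReal_re]
  positivity

theorem IsReproducingKernel.ofReal_re_diag (hK : IsReproducingKernel μ K) (z : D) :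
    ((K z z).re : ℂ) = K z z := by
  rw [← hK.norm_sq_toLp, Complex.ofReal_re]

theorem IsReproducingKernel.lintegral_enorm_sq (hK : IsReproducingKernel μ K) (z : D) :
    ∫⁻ w, ‖K w z‖ₑ ^ 2 ∂μ = ENNReal.ofReal (K z z).re := by
  rw [lintegral_enorm_sq_eq, ← hK.norm_sq_toLp, Complex.ofReal_re,
    ENNReal.ofReal_pow (norm_nonneg _), ofReal_norm, Lp.enorm_toLp]

theorem IsReproducingKernel.re_diag_pos (hK : IsReproducingKernel μ K) {f : D → ℂ}
    (hf : IsHolomorphic f) (hfL : MemLp f 2 μ) {z : D} (hfz : f z ≠ 0) : 0 < (K z z).re := by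
  refine (hK.re_diag_nonneg z).lt_of_ne fun hdiag => hfz ?_
  have hnorm := hK.lintegral_enorm_sq z
  have hm := (hK.holo z).continuous.measurable
  rw [← hdiag, ENNReal.ofReal_zero, lintegral_eq_zero_iff (by fun_prop)] at hnorm
  rw [hK.reproducing f hf hfL z]
  refine integral_eq_zero_of_ae ?_
  filter_upwards [hnorm] with w hw
  rw [Pi.zero_apply, sq_eq_zero_iff, enorm_eq_zero] at hw
  rw [hK.hermitian z w, hw, map_zero, mul_zero, Pi.zero_apply]

theorem IsReproducingKernel.norm_comm (hK : IsReproducingKernel μ K) (z w : D) :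
    ‖K z w‖ = ‖K w z‖ := by
  rw [hK.hermitian, RCLike.norm_conj]

theorem IsReproducingKernel.norm_sq_le (hK : IsReproducingKernel μ K) (z w : D) :
    ‖K z w‖ ^ 2 ≤ (K z z).re * (K w w).re := by
  rw [← hK.norm_sq_toLp z, ← hK.norm_sq_toLp w, Complex.ofReal_re, Complex.ofReal_re,
    ← hK.inner_toLp, ← mul_pow]
  gcongr
  exact norm_inner_le_norm _ _

theorem IsReproducingKernel.exists_re_diag_le (hK : IsReproducingKernel μ K)
    (hμ : EvalBounded μ) {A : Set D} (hA : IsCompact A) :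
    ∃ C : ℝ≥0, ∀ z ∈ A, (K z z).re ≤ C := by
  obtain ⟨C, hC⟩ := hμ A hA
  refine ⟨C, fun z hz => ?_⟩
  have hnonneg := hK.re_diag_nonneg z
  have hle : (K z z).re ^ 2 ≤ C * (K z z).re := by
    have henorm := hC _ (hK.holo z) z hz
    have hnorm : ‖K z z‖ = (K z z).re := by
      rw [← hK.ofReal_re_diag, Complex.norm_of_nonneg hnonneg, Complex.ofReal_re]
    rw [hK.lintegral_enorm_sq] at henorm
    simpa [hnonneg, hnorm] using ENNReal.toReal_mono (by finiteness) henorm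
  nlinarith [C.2]

theorem IsReproducingKernel.exists_norm_le (hK : IsReproducingKernel μ K) (hμ : EvalBounded μ)
    {A : Set D} (hA : IsCompact A) : ∃ C : ℝ, ∀ z ∈ A, ∀ w ∈ A, ‖K z w‖ ≤ C := by
  obtain ⟨C, hC⟩ := hK.exists_re_diag_le hμ hA
  refine ⟨C, fun z hz w hw => le_of_sq_le_sq ?_ C.2⟩
  calc ‖K z w‖ ^ 2 ≤ (K z z).re * (K w w).re := hK.norm_sq_le z w
    _ ≤ C * C := mul_le_mul (hC z hz) (hC w hw) (hK.re_diag_nonneg _) C.2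
    _ = (C : ℝ) ^ 2 := (sq _).symm

theorem exists_isCompact_closedBall (hD : IsOpen D) (a : D) : ∃ r > 0,
    closedBall (a : Fin n → ℂ) r ⊆ D ∧
      IsCompact ((↑) ⁻¹' closedBall (a : Fin n → ℂ) r : Set D) := by
  obtain ⟨r, hr, hrD⟩ := Metric.nhds_basis_closedBall.mem_iff.1 (hD.mem_nhds a.2)
  exact ⟨r, hr, hrD, isCompact_preimage_coe (isCompact_closedBall _ _) hrD⟩

theorem IsHolomorphic.dist_le_div_mul_dist {f : D → ℂ} (hf : IsHolomorphic f) {a : D} {r M : ℝ}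
    (hrD : closedBall (a : Fin n → ℂ) r ⊆ D) (hM : ∀ z : D, dist z a ≤ r → ‖f z‖ ≤ M) {z : D}
    (hz : dist z a < r) : dist (f z) (f a) ≤ 2 * M / r * dist z a := by
  have hmaps : MapsTo (Function.extend Subtype.val f 0) (ball (a : Fin n → ℂ) r)
      (closedBall (Function.extend Subtype.val f 0 a) (2 * M)) := by
    intro y hy
    lift y to D using hrD (ball_subset_closedBall hy)
    rw [mem_closedBall, extend_coe, extend_coe, dist_eq_norm]
    linarith [norm_sub_le (f y) (f a), hM y (mem_ball.1 hy).le,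
      hM a ((dist_self a).trans_le (dist_nonneg.trans hz.le))]
  have hle := Complex.dist_le_div_mul_dist_of_mapsTo_ball (z := (z : Fin n → ℂ))
    (DifferentiableOn.mono hf (ball_subset_closedBall.trans hrD)) hmaps hz
  rwa [extend_coe, extend_coe] at hle

theorem IsReproducingKernel.continuous_diag (hK : IsReproducingKernel μ K) (hD : IsOpen D)
    (hμ : EvalBounded μ) : Continuous fun z => K z z := by
  refine continuous_iff_continuousAt.2 fun a => ?_
  obtain ⟨r, hr, hrD, hrc⟩ := exists_isCompact_closedBall hD a
  obtain ⟨M, hM⟩ := hK.exists_norm_le hμ hrc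
  have hfst : Tendsto (fun z => K z z - K a z) (𝓝 a) (𝓝 0) := by
    refine squeeze_zero_norm' (a := fun z : D => 2 * M / r * dist z a) ?_ ?_
    · filter_upwards [ball_mem_nhds a hr] with z hz
      rw [← dist_eq_norm]
      exact (hK.holo z).dist_le_div_mul_dist hrD (fun y hy => hM y hy z (mem_ball.1 hz).le) hz
    · exact Continuous.tendsto' (by fun_prop) _ _ (by simp)
  have hsnd : Continuous fun z => K a z := by
    simp_rw [hK.hermitian a]
    exact Complex.continuous_conj.comp (hK.holo a).continuous
  simpa [ContinuousAt] using hfst.add (hsnd.tendsto a)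

theorem eq_zero_of_hermitian_of_diag_eq_zero (hD : IsOpen D) (hDc : IsPreconnected D)
    {H : D → D → ℂ} (hholo : ∀ w, IsHolomorphic fun z => H z w)
    (hherm : ∀ z w, H z w = conj (H w z))
    (hb : ∀ A : Set D, IsCompact A → ∃ M, ∀ z ∈ A, ∀ w ∈ A, ‖H z w‖ ≤ M)
    (hdiag : ∀ z, H z z = 0) (z w : D) : H z w = 0 := by
  set h : (Fin n → ℂ) → (Fin n → ℂ) → ℂ := fun z w =>
    Function.extend Subtype.val (fun z' => Function.extend Subtype.val (H z') 0 w) 0 z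
  have hval : ∀ z w : D, h z w = H z w := fun z w =>
    (extend_coe (fun z' => Function.extend Subtype.val (H z') 0 (w : Fin n → ℂ)) z).trans
      (extend_coe (H z) w)
  have hsesqui : IsSesquiholomorphicOn h D := by
    refine ⟨fun w hw => ?_, fun z hz => ?_⟩
    · lift w to D using hw
      exact DifferentiableOn.congr (hholo w) fun z hz =>
        (hval ⟨z, hz⟩ w).trans (extend_coe (fun z => H z w) ⟨z, hz⟩).symm
    · lift z to D using hz
      refine DifferentiableOn.congr (hholo z) fun w hw => ?_
      lift w to D using hw
      rw [hval, ← hherm]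
      exact (extend_coe (fun w => H w z) w).symm
  rw [← hval]
  refine hsesqui.eq_zero_of_diag_eq_zero hD hDc (fun a ha => ?_) (fun z hz => ?_) z.2 w.2
  · obtain ⟨r, hr, hrD, hrc⟩ := exists_isCompact_closedBall hD ⟨a, ha⟩
    obtain ⟨M, hM⟩ := hb _ hrc
    refine ⟨_, closedBall_mem_nhds a hr, M, fun z hz w hw => ?_⟩
    exact (congrArg norm (hval ⟨z, hrD hz⟩ ⟨w, hrD hw⟩)).trans_le (hM _ hz _ hw)
  · exact (hval ⟨z, hz⟩ ⟨z, hz⟩).trans (hdiag _)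

theorem IsReproducingKernel.eq_const_mul_pow (hK : IsReproducingKernel μ K) (hD : IsOpen D)
    (hDc : IsPreconnected D) (hμ : EvalBounded μ) {ν : Measure D} (hν : EvalBounded ν)
    {L : D → D → ℂ} (hL : IsReproducingKernel ν L) {c : ℝ} {k : ℕ}
    (hdiag : ∀ z, L z z = c * K z z ^ k) (z w : D) : L z w = c * K z w ^ k := by
  refine sub_eq_zero.1 (eq_zero_of_hermitian_of_diag_eq_zero hD hDc
    (H := fun z w => L z w - c * K z w ^ k) (fun w => ?_) (fun z w => ?_) (fun A hA => ?_)
    (fun z => sub_eq_zero.2 (hdiag z)) z w)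
  · exact (hL.holo w).sub ((isHolomorphic_const (c : ℂ)).mul ((hK.holo w).pow k))
  · simp only [map_sub, map_mul, map_pow, Complex.conj_ofReal, ← hL.hermitian, ← hK.hermitian]
  · obtain ⟨M, hM⟩ := hK.exists_norm_le hμ hA
    obtain ⟨N, hN⟩ := hL.exists_norm_le hν hA
    refine ⟨N + |c| * M ^ k, fun z hz w hw => (norm_sub_le _ _).trans ?_⟩
    rw [norm_mul, norm_pow, Complex.norm_real, Real.norm_eq_abs]
    gcongr
    exacts [hN z hz w hw, hM z hz w hw]

end Kernels

/-! ### Automorphisms and quasi-invariant measures -/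

section Automorphisms

variable {n : ℕ} {D : Set (Fin n → ℂ)}

theorem isHolomorphic_smul (g : Aut D) : IsHolomorphic fun z : D => ((g • z : D) : Fin n → ℂ) :=
  g.2.1

theorem continuous_aut_smul (g : Aut D) : Continuous fun z : D => g • z :=
  Continuous.subtype_mk (isHolomorphic_smul g).continuous _

theorem measurableEmbedding_aut_smul (g : Aut D) : MeasurableEmbedding fun z : D => g • z :=
  (MeasurableEquiv.mk (MulAction.toPerm g) (continuous_aut_smul g).measurable
    (continuous_aut_smul g⁻¹).measurable).measurableEmbedding

theorem IsHolomorphic.comp_smul {F : Type*} [NormedAddCommGroup F] [NormedSpace ℂ F] {f : D → F}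
    (hf : IsHolomorphic f) (g : Aut D) : IsHolomorphic fun z => f (g • z) :=
  hf.comp_val (isHolomorphic_smul g)

/-- The extension by zero of an automorphism of `D` to `ℂⁿ`, whose Fréchet derivative defines
`jacobian`. -/
noncomputable def autExt (g : Aut D) : (Fin n → ℂ) → (Fin n → ℂ) :=
  Function.extend Subtype.val (fun w : D => ((g • w : D) : Fin n → ℂ)) 0

theorem autExt_coe (g : Aut D) (z : D) : autExt g z = (g • z : D) := extend_coe _ z

theorem jacobian_eq (g : Aut D) (z : D) : jacobian g z = (fderiv ℂ (autExt g) z).det := rfl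

theorem differentiableAt_autExt (hD : IsOpen D) (g : Aut D) (z : D) :
    DifferentiableAt ℂ (autExt g) z :=
  (isHolomorphic_smul g).differentiableAt hD z

theorem injOn_autExt (g : Aut D) : InjOn (autExt g) D := by
  intro y hy z hz h
  lift y to D using hy
  lift z to D using hz
  rw [autExt_coe, autExt_coe] at h
  exact congrArg Subtype.val (MulAction.injective g (Subtype.ext h))

theorem image_autExt (g : Aut D) : autExt g '' D = D := by
  refine Subset.antisymm (image_subset_iff.2 fun z hz => ?_) fun z hz => ?_
  · lift z to D using hz
    exact mem_preimage.2 (autExt_coe g z ▸ Subtype.coe_prop _)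
  · lift z to D using hz
    exact ⟨(g⁻¹ • z : D), Subtype.coe_prop _, by rw [autExt_coe, smul_inv_smul]⟩

theorem jacobian_mul (hD : IsOpen D) (g h : Aut D) (z : D) :
    jacobian (g * h) z = jacobian g (h • z) * jacobian h z := by
  have hcomp : autExt (g * h) =ᶠ[𝓝 (z : Fin n → ℂ)] autExt g ∘ autExt h := by
    filter_upwards [hD.mem_nhds z.2] with y hy
    lift y to D using hy
    simp only [Function.comp_apply, autExt_coe, mul_smul]
  have hg : DifferentiableAt ℂ (autExt g) (autExt h z) := by
    rw [autExt_coe]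
    exact differentiableAt_autExt hD g _
  simp only [jacobian_eq]
  rw [hcomp.fderiv_eq, fderiv_comp _ hg (differentiableAt_autExt hD h z), autExt_coe]
  exact LinearMap.det_comp _ _

theorem jacobian_one (hD : IsOpen D) (z : D) : jacobian (1 : Aut D) z = 1 := by
  have hid : autExt (1 : Aut D) =ᶠ[𝓝 (z : Fin n → ℂ)] id := by
    filter_upwards [hD.mem_nhds z.2] with y hy
    lift y to D using hy
    rw [autExt_coe, one_smul, id]
  rw [jacobian_eq, hid.fderiv_eq, fderiv_id]
  exact LinearMap.det_id

theorem jacobian_inv_mul (hD : IsOpen D) (g : Aut D) (z : D) :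
    jacobian g⁻¹ (g • z) * jacobian g z = 1 := by
  rw [← jacobian_mul hD, inv_mul_cancel, jacobian_one hD]

theorem jacobian_ne_zero (hD : IsOpen D) (g : Aut D) (z : D) : jacobian g z ≠ 0 :=
  right_ne_zero_of_mul_eq_one (jacobian_inv_mul hD g z)

theorem isHolomorphic_jacobian (hD : IsOpen D) (g : Aut D) : IsHolomorphic (jacobian g) := by
  refine isHolomorphic_of_eqOn (u := fun z => (fderiv ℂ (autExt g) z).det) ?_ fun z => rfl
  have hentry : ∀ i j : Fin n,
      DifferentiableOn ℂ (fun z => fderiv ℂ (autExt g) z (Pi.single j 1) i) D := fun i j =>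
    differentiableOn_pi.1 (differentiableOn_fderiv_apply hD (isHolomorphic_smul g) _) i
  have hdet : (fun z => (fderiv ℂ (autExt g) z).det) = fun z =>
      ∑ σ : Equiv.Perm (Fin n), ((Equiv.Perm.sign σ : ℤ) : ℂ) *
        ∏ i, fderiv ℂ (autExt g) z (Pi.single i 1) (σ i) := by
    funext z
    rw [ContinuousLinearMap.det, ← LinearMap.det_toMatrix', Matrix.det_apply']
    simp [LinearMap.toMatrix'_apply]
  rw [hdet]
  refine DifferentiableOn.fun_sum fun σ _ => DifferentiableOn.const_mul ?_ _
  exact fun z hz => (HasFDerivWithinAt.finsetProd fun i _ =>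
    (hentry (σ i) i z hz).hasFDerivWithinAt).differentiableWithinAt

theorem continuous_jacobian (hD : IsOpen D) (g : Aut D) : Continuous (jacobian g) :=
  (isHolomorphic_jacobian hD g).continuous

/-- The measure `|J(g, ·)|^{2k} μ` is carried to `μ` by every automorphism `g`, expressed on
nonnegative functions. -/
def QuasiInvariant (k : ℕ) (μ : Measure D) : Prop :=
  ∀ (g : Aut D) (u : D → ℝ≥0∞), Measurable u →
    ∫⁻ z, (‖jacobian g z‖ₑ ^ 2) ^ k * u (g • z) ∂μ = ∫⁻ z, u z ∂μ

theorem abs_det_restrictScalars (L : (Fin n → ℂ) →L[ℂ] (Fin n → ℂ)) :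
    |(L.restrictScalars ℝ).det| = ‖L.det‖ ^ 2 := by
  have hdet : (L.restrictScalars ℝ).det = ‖L.det‖ ^ 2 := by
    simp [ContinuousLinearMap.det, LinearMap.det_restrictScalars, Algebra.norm_complex_eq,
      Complex.normSq_eq_norm_sq]
  rw [hdet, abs_of_nonneg (by positivity)]

theorem quasiInvariant_eucVolume (hD : IsOpen D) : QuasiInvariant 1 (eucVolume D) := by
  intro g u _
  have hvol := lintegral_image_eq_lintegral_abs_det_fderiv_mul volume hD.measurableSet
    (f' := fun z => (fderiv ℂ (autExt g) z).restrictScalars ℝ)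
    (fun z hz => ((differentiableAt_autExt hD g ⟨z, hz⟩).hasFDerivAt.restrictScalars
      ℝ).hasFDerivWithinAt) (injOn_autExt g) (Function.extend Subtype.val u 0)
  rw [image_autExt, ← lintegral_subtype_comap hD.measurableSet,
    ← lintegral_subtype_comap hD.measurableSet] at hvol
  simp only [Subtype.val_injective.extend_apply, autExt_coe, abs_det_restrictScalars] at hvol
  rw [eucVolume, hvol]
  refine lintegral_congr fun z => ?_
  rw [pow_one, jacobian_eq, ENNReal.ofReal_pow (norm_nonneg _), ofReal_norm]

variable {μ : Measure D} {k : ℕ}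

theorem QuasiInvariant.withDensity (hμ : QuasiInvariant k μ) (hD : IsOpen D) {l : ℕ}
    {ω : D → ℝ≥0∞} (hω : Measurable ω) (hωJ : ∀ (g : Aut D) z,
      (‖jacobian g z‖ₑ ^ 2) ^ l * ω z = (‖jacobian g z‖ₑ ^ 2) ^ k * ω (g • z)) :
    QuasiInvariant l (μ.withDensity ω) := by
  intro g u hu
  have hg := (continuous_aut_smul g).measurable
  have hJ := (continuous_jacobian hD g).measurable
  rw [lintegral_withDensity_eq_lintegral_mul _ hω (by fun_prop),
    lintegral_withDensity_eq_lintegral_mul _ hω hu, ← hμ g _ (hω.mul hu)]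
  refine lintegral_congr fun z => ?_
  simp only [Pi.mul_apply]
  rw [← mul_assoc, ← mul_assoc, mul_comm (ω z), hωJ]

theorem QuasiInvariant.measurePreserving (hμ : QuasiInvariant k μ) (hD : IsOpen D) (g : Aut D) :
    MeasurePreserving (fun z : D => g • z)
      (μ.withDensity fun z => (‖jacobian g z‖ₑ ^ 2) ^ k) μ := by
  have hg := (continuous_aut_smul g).measurable
  have hJ := (continuous_jacobian hD g).measurable
  refine ⟨hg, Measure.ext fun s hs => ?_⟩
  have hs1 : Measurable (s.indicator (1 : D → ℝ≥0∞)) := measurable_one.indicator hs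
  rw [← lintegral_indicator_one hs, ← lintegral_indicator_one hs, lintegral_map hs1 hg,
    ← hμ g _ hs1]
  exact lintegral_withDensity_eq_lintegral_mul _ (by fun_prop) (hs1.comp hg)

theorem norm_sq_pow_eq_mul_conj (a : ℂ) (k : ℕ) :
    (((‖a‖ ^ 2) ^ k : ℝ) : ℂ) = a ^ k * conj a ^ k := by
  rw [← mul_pow, Complex.mul_conj, Complex.normSq_eq_norm_sq, Complex.ofReal_pow]

theorem QuasiInvariant.integral_comp (hμ : QuasiInvariant k μ) (hD : IsOpen D) (g : Aut D)
    (F : D → ℂ) :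
    ∫ z, jacobian g z ^ k * conj (jacobian g z) ^ k * F (g • z) ∂μ = ∫ z, F z ∂μ := by
  have hJ := (continuous_jacobian hD g).measurable
  rw [← (hμ.measurePreserving hD g).integral_comp (measurableEmbedding_aut_smul g) F,
    integral_withDensity_eq_integral_toReal_smul (by fun_prop) (.of_forall fun z => by finiteness)]
  refine integral_congr_ae (.of_forall fun z => ?_)
  simp only [← norm_sq_pow_eq_mul_conj]
  simp

/-- The weight `k` action of an automorphism on functions. -/
noncomputable def slash (k : ℕ) (g : Aut D) (f : D → ℂ) (z : D) : ℂ :=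
  f (g • z) * jacobian g z ^ k

theorem slash_inv_smul (hD : IsOpen D) (k : ℕ) (g : Aut D) (f : D → ℂ) (z : D) :
    slash k g⁻¹ f (g • z) * jacobian g z ^ k = f z := by
  rw [slash, inv_smul_smul, mul_assoc, ← mul_pow, jacobian_inv_mul hD, one_pow, mul_one]

theorem IsHolomorphic.slash {f : D → ℂ} (hf : IsHolomorphic f) (hD : IsOpen D) (k : ℕ)
    (g : Aut D) : IsHolomorphic (slash k g f) :=
  (hf.comp_smul g).mul ((isHolomorphic_jacobian hD g).pow k)

theorem QuasiInvariant.lintegral_slash (hμ : QuasiInvariant k μ) (g : Aut D) {f : D → ℂ}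
    (hf : IsHolomorphic f) {S : Set D} (hS : MeasurableSet S) :
    ∫⁻ z in S, ‖slash k g f z‖ₑ ^ 2 ∂μ = ∫⁻ z in (g⁻¹ • · ) ⁻¹' S, ‖f z‖ₑ ^ 2 ∂μ := by
  have hS' : MeasurableSet ((g⁻¹ • · ) ⁻¹' S : Set D) := (continuous_aut_smul g⁻¹).measurable hS
  have hfm := hf.continuous.measurable
  rw [← lintegral_indicator hS, ← lintegral_indicator hS',
    ← hμ g _ (Measurable.indicator (by fun_prop) hS')]
  refine lintegral_congr fun z => ?_
  by_cases hz : z ∈ S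
  · rw [indicator_of_mem hz, indicator_of_mem (by simpa using hz), slash, enorm_mul, enorm_pow]
    ring
  · rw [indicator_of_notMem hz, indicator_of_notMem (by simpa using hz), mul_zero]

theorem IsHolomorphic.memLp_two_iff {f : D → ℂ} (hf : IsHolomorphic f) :
    MemLp f 2 μ ↔ ∫⁻ z, ‖f z‖ₑ ^ 2 ∂μ < ∞ := by
  rw [lintegral_enorm_sq_eq]
  refine ⟨fun h => ENNReal.pow_lt_top h.2, fun h => ⟨hf.continuous.aestronglyMeasurable, ?_⟩⟩
  simpa using h

theorem QuasiInvariant.memLp_slash (hμ : QuasiInvariant k μ) (hD : IsOpen D) (g : Aut D)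
    {f : D → ℂ} (hf : IsHolomorphic f) (hfL : MemLp f 2 μ) : MemLp (slash k g f) 2 μ := by
  have hslash := hμ.lintegral_slash g hf MeasurableSet.univ
  rw [preimage_univ, Measure.restrict_univ] at hslash
  rw [(hf.slash hD k g).memLp_two_iff, hslash]
  exact hf.memLp_two_iff.1 hfL

theorem IsReproducingKernel.transform {K : D → D → ℂ} (hK : IsReproducingKernel μ K)
    (hD : IsOpen D) (hμ : QuasiInvariant k μ) (g : Aut D) (z w : D) :
    K (g • z) (g • w) * jacobian g z ^ k * conj (jacobian g w) ^ k = K z w := by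
  have htransf : IsReproducingKernel μ fun z w =>
      K (g • z) (g • w) * jacobian g z ^ k * conj (jacobian g w) ^ k := by
    refine ⟨fun w => ?_, fun w => ?_, fun z w => ?_, fun f hf hfL z => ?_⟩
    · exact ((hK.holo (g • w)).slash hD k g).mul (isHolomorphic_const _)
    · exact (hμ.memLp_slash hD g (hK.holo (g • w)) (hK.memLp (g • w))).mul_const _
    · simp only [map_mul, map_pow, Complex.conj_conj, ← hK.hermitian]
      ring
    · rw [← slash_inv_smul hD k g f z, hK.reproducing _ (hf.slash hD k g⁻¹)
        (hμ.memLp_slash hD g⁻¹ hf hfL) (g • z), ← hμ.integral_comp hD g, ← integral_mul_const]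
      refine integral_congr_ae (.of_forall fun w => ?_)
      simp only [← slash_inv_smul hD k g f w]
      ring
  exact congrFun₂ (htransf.unique hK) z w

theorem IsReproducingKernel.re_diag_smul {K : D → D → ℂ} (hK : IsReproducingKernel μ K)
    (hD : IsOpen D) (hμ : QuasiInvariant k μ) (g : Aut D) (z : D) :
    (K (g • z) (g • z)).re * (‖jacobian g z‖ ^ 2) ^ k = (K z z).re := by
  have h := hK.transform hD hμ g z z
  rw [mul_assoc, ← norm_sq_pow_eq_mul_conj, ← hK.ofReal_re_diag, ← hK.ofReal_re_diag z] at h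
  exact_mod_cast h

end Automorphisms

/-! ### The Bergman kernel and its weights -/

section Bergman

variable {n : ℕ} {D : Set (Fin n → ℂ)}

theorem evalBounded_eucVolume (hD : IsOpen D) : EvalBounded (eucVolume D) := by
  intro A hA
  obtain ⟨A', -, C, hC⟩ := exists_enorm_sq_le_setLIntegral hD hA
  refine ⟨C, fun f hf z hz => (hC f hf z hz).trans ?_⟩
  gcongr
  exact Measure.restrict_le_self

theorem setLIntegral_le_inv_mul_lintegral_withDensity {X : Type*} [MeasurableSpace X]
    {ν : Measure X} {ω u : X → ℝ≥0∞} (hω : Measurable ω) (hu : Measurable u) {A : Set X}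
    (hA : MeasurableSet A) {δ : ℝ≥0} (hδ : δ ≠ 0) (hδω : ∀ x ∈ A, δ ≤ ω x) :
    ∫⁻ x in A, u x ∂ν ≤ (δ : ℝ≥0∞)⁻¹ * ∫⁻ x, u x ∂(ν.withDensity ω) := by
  rw [← ENNReal.mul_le_iff_le_inv (ENNReal.coe_ne_zero.2 hδ) ENNReal.coe_ne_top,
    lintegral_withDensity_eq_lintegral_mul _ hω hu, ← lintegral_const_mul _ hu]
  calc ∫⁻ x in A, δ * u x ∂ν ≤ ∫⁻ x in A, ω x * u x ∂ν :=
        setLIntegral_mono' hA fun x hx => by gcongr; exact hδω x hx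
    _ ≤ ∫⁻ x, ω x * u x ∂ν := setLIntegral_le_lintegral _ _

theorem evalBounded_withDensity (hD : IsOpen D) {ω : D → ℝ} (hω : Continuous ω)
    (hpos : ∀ z, 0 < ω z) :
    EvalBounded ((eucVolume D).withDensity fun z => ENNReal.ofReal (ω z)) := by
  intro A hA
  obtain ⟨A', hA', C, hC⟩ := exists_enorm_sq_le_setLIntegral hD hA
  obtain ⟨δ, hδ, hδω⟩ : ∃ δ : ℝ≥0, δ ≠ 0 ∧ ∀ z ∈ A', (δ : ℝ≥0∞) ≤ ENNReal.ofReal (ω z) := by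
    rcases A'.eq_empty_or_nonempty with rfl | hne
    · exact ⟨1, one_ne_zero, by simp⟩
    · obtain ⟨a, -, ha⟩ := hA'.exists_isMinOn hne hω.continuousOn
      exact ⟨(ω a).toNNReal, (Real.toNNReal_pos.2 (hpos a)).ne',
        fun z hz => ENNReal.ofReal_le_ofReal (ha hz)⟩
  refine ⟨C * δ⁻¹, fun f hf z hz => (hC f hf z hz).trans ?_⟩
  have hfm := hf.continuous.measurable
  have hωm := hω.measurable
  rw [ENNReal.coe_mul, mul_assoc, ENNReal.coe_inv hδ]
  gcongr
  exact setLIntegral_le_inv_mul_lintegral_withDensity (by fun_prop) (by fun_prop)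
    hA'.measurableSet hδ hδω

theorem isReproducingKernel_bergmanKernel (hD : IsOpen D) :
    IsReproducingKernel (eucVolume D) (bergmanKernel D) := by
  have hex : ∃ K, IsBergmanKernel D K := by
    obtain ⟨K, hK⟩ := exists_isReproducingKernel hD (evalBounded_eucVolume hD)
    exact ⟨K, fun w => ⟨hK.holo w, hK.memLp w⟩, hK.hermitian,
      fun f hf z => hK.reproducing f hf.1 hf.2 z⟩
  have hK : IsBergmanKernel D (bergmanKernel D) := by
    rw [bergmanKernel, dif_pos hex]
    exact hex.choose_spec
  exact ⟨fun w => (hK.mem w).1, fun w => (hK.mem w).2, hK.hermitian,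
    fun f hf hfL z => hK.reproducing f ⟨hf, hfL⟩ z⟩

/-- The Bergman kernel `𝒦(z, z)` on the diagonal, as a real number. -/
noncomputable def bergmanDiag (z : D) : ℝ := (bergmanKernel D z z).re

theorem ofReal_bergmanDiag (hD : IsOpen D) (z : D) :
    (bergmanDiag z : ℂ) = bergmanKernel D z z :=
  (isReproducingKernel_bergmanKernel hD).ofReal_re_diag z

theorem continuous_bergmanDiag (hD : IsOpen D) : Continuous (bergmanDiag (D := D)) :=
  Complex.continuous_re.comp
    ((isReproducingKernel_bergmanKernel hD).continuous_diag hD (evalBounded_eucVolume hD))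

theorem measurable_bergmanDiag (hD : IsOpen D) : Measurable (bergmanDiag (D := D)) :=
  (continuous_bergmanDiag hD).measurable

theorem isFiniteMeasure_eucVolume (hD : IsOpen D) (hb : Bornology.IsBounded D) :
    IsFiniteMeasure (eucVolume D) := by
  refine ⟨?_⟩
  rw [eucVolume, comap_subtype_coe_apply hD.measurableSet]
  exact (measure_mono (Subtype.coe_image_subset D univ)).trans_lt hb.measure_lt_top

theorem bergmanDiag_pos (hD : IsOpen D) (hb : Bornology.IsBounded D) (z : D) :
    0 < bergmanDiag z := by
  have := isFiniteMeasure_eucVolume hD hb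
  exact (isReproducingKernel_bergmanKernel hD).re_diag_pos (isHolomorphic_const 1)
    (memLp_const 1) one_ne_zero

theorem bergmanKernel_self_ne_zero (hD : IsOpen D) (hb : Bornology.IsBounded D) (z : D) :
    bergmanKernel D z z ≠ 0 := by
  rw [← ofReal_bergmanDiag hD]
  exact Complex.ofReal_ne_zero.2 (bergmanDiag_pos hD hb z).ne'

theorem bergmanDiag_smul (hD : IsOpen D) (g : Aut D) (z : D) :
    bergmanDiag (g • z) * ‖jacobian g z‖ ^ 2 = bergmanDiag z := by
  simpa only [bergmanDiag, pow_one] using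
    (isReproducingKernel_bergmanKernel hD).re_diag_smul hD (quasiInvariant_eucVolume hD) g z

variable (D) in
/-- The measure `𝒦(z,z)^{-k} dV(z)`, whose square integrable holomorphic functions form the weight
`k` Bergman space. -/
noncomputable def weightVolume (k : ℕ) : Measure D :=
  (eucVolume D).withDensity fun z => ENNReal.ofReal (bergmanDiag z * (bergmanDiag z ^ k)⁻¹)

theorem weightVolume_zero : weightVolume D 0 = invVolume D := by
  simp only [weightVolume, pow_zero, inv_one, mul_one, invVolume, bergmanDiag]

/-- The Berezin function `|𝒦(w,p)|² / (𝒦(p,p) 𝒦(w,w))`. -/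
noncomputable def berezin (p w : D) : ℝ :=
  ‖bergmanKernel D w p‖ ^ 2 / (bergmanDiag p * bergmanDiag w)

theorem measurable_berezin (hD : IsOpen D) (p : D) : Measurable (berezin p) := by
  have hK := ((isReproducingKernel_bergmanKernel hD).holo p).continuous.measurable
  have hdiag := measurable_bergmanDiag hD
  unfold berezin
  fun_prop

variable (hD : IsOpen D) (hb : Bornology.IsBounded D)

include hD hb

theorem evalBounded_weightVolume (k : ℕ) : EvalBounded (weightVolume D k) := by
  have hpos := bergmanDiag_pos hD hb
  refine evalBounded_withDensity hD (ω := fun z => bergmanDiag z * (bergmanDiag z ^ k)⁻¹) ?_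
    fun z => mul_pos (hpos z) (inv_pos.2 (pow_pos (hpos z) k))
  exact (continuous_bergmanDiag hD).mul
    (((continuous_bergmanDiag hD).pow k).inv₀ fun z => (pow_pos (hpos z) k).ne')

theorem quasiInvariant_weightVolume (k : ℕ) : QuasiInvariant k (weightVolume D k) := by
  have hm := measurable_bergmanDiag hD
  refine (quasiInvariant_eucVolume hD).withDensity hD (by fun_prop) fun g z => ?_
  rw [← ofReal_norm, ← ENNReal.ofReal_pow (norm_nonneg _), ← ENNReal.ofReal_pow (by positivity),
    ← ENNReal.ofReal_pow (by positivity), ← ENNReal.ofReal_mul (by positivity),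
    ← ENNReal.ofReal_mul (by positivity), ← bergmanDiag_smul hD g z]
  congr 1
  have hdiag := (bergmanDiag_pos hD hb (g • z)).ne'
  have hJ := norm_ne_zero_iff.2 (jacobian_ne_zero hD g z)
  field_simp
  rw [mul_pow]

theorem quasiInvariant_invVolume : QuasiInvariant 0 (invVolume D) := by
  rw [← weightVolume_zero]
  exact quasiInvariant_weightVolume hD hb 0

theorem weightVolume_eq (k : ℕ) : weightVolume D k =
    (invVolume D).withDensity fun z => ENNReal.ofReal (bergmanDiag z ^ k)⁻¹ := by
  have hm := measurable_bergmanDiag hD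
  simp only [weightVolume, ENNReal.ofReal_mul (bergmanDiag_pos hD hb _).le]
  exact withDensity_mul _ (by fun_prop) (by fun_prop)

theorem integral_weightVolume (k : ℕ) (f : D → ℂ) :
    ∫ z, f z ∂(weightVolume D k) =
      ∫ z, f z * ((bergmanDiag z ^ k)⁻¹ : ℝ) ∂(invVolume D) := by
  have hpos := bergmanDiag_pos hD hb
  have hm := measurable_bergmanDiag hD
  rw [weightVolume_eq hD hb, integral_withDensity_eq_integral_toReal_smul (by fun_prop)
    (.of_forall fun z => ENNReal.ofReal_lt_top)]
  refine integral_congr_ae (.of_forall fun z => ?_)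
  simp only
  rw [ENNReal.toReal_ofReal (inv_nonneg.2 (pow_nonneg (hpos z).le k)), Complex.real_smul, mul_comm]

theorem norm_sq_bergmanKernel (p w : D) :
    ‖bergmanKernel D w p‖ ^ 2 = berezin p w * (bergmanDiag p * bergmanDiag w) :=
  (div_mul_cancel₀ _
    (mul_pos (bergmanDiag_pos hD hb p) (bergmanDiag_pos hD hb w)).ne').symm

theorem berezin_nonneg (p w : D) : 0 ≤ berezin p w :=
  div_nonneg (sq_nonneg _)
    (mul_nonneg (bergmanDiag_pos hD hb p).le (bergmanDiag_pos hD hb w).le)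

theorem berezin_le_one (p w : D) : berezin p w ≤ 1 := by
  have hle := (isReproducingKernel_bergmanKernel hD).norm_sq_le w p
  rw [mul_comm] at hle
  exact div_le_one_of_le₀ hle
    (mul_nonneg (bergmanDiag_pos hD hb p).le (bergmanDiag_pos hD hb w).le)

theorem lintegral_berezin (p : D) :
    ∫⁻ w, ENNReal.ofReal (berezin p w) ∂(invVolume D) = 1 := by
  have hpos := bergmanDiag_pos hD hb
  have hm := measurable_bergmanDiag hD
  have hm' := measurable_berezin hD p
  have hdensity : ∀ w, ENNReal.ofReal (bergmanDiag w) * ENNReal.ofReal (berezin p w) =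
      ENNReal.ofReal (bergmanDiag p)⁻¹ * ‖bergmanKernel D w p‖ₑ ^ 2 := fun w => by
    have hp := hpos p
    rw [← ENNReal.ofReal_mul (hpos w).le, ← ofReal_norm, ← ENNReal.ofReal_pow (norm_nonneg _),
      ← ENNReal.ofReal_mul (by positivity), norm_sq_bergmanKernel hD hb]
    congr 1
    field_simp
  calc ∫⁻ w, ENNReal.ofReal (berezin p w) ∂(invVolume D)
      = ∫⁻ w, ENNReal.ofReal (bergmanDiag w) * ENNReal.ofReal (berezin p w) ∂(eucVolume D) :=
        lintegral_withDensity_eq_lintegral_mul _ (hm.ennreal_ofReal) (by fun_prop)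
    _ = ENNReal.ofReal (bergmanDiag p)⁻¹ * ENNReal.ofReal (bergmanDiag p) := by
        simp_rw [hdensity]
        rw [lintegral_const_mul' _ _ ENNReal.ofReal_ne_top,
          (isReproducingKernel_bergmanKernel hD).lintegral_enorm_sq, bergmanDiag]
    _ = 1 := by
        rw [← ENNReal.ofReal_mul (inv_nonneg.2 (hpos p).le), inv_mul_cancel₀ (hpos p).ne',
          ENNReal.ofReal_one]

theorem integrable_berezin (p : D) : Integrable (berezin p) (invVolume D) := by
  refine ⟨(measurable_berezin hD p).aestronglyMeasurable, ?_⟩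
  rw [hasFiniteIntegral_iff_ofReal (.of_forall (berezin_nonneg hD hb p)), lintegral_berezin hD hb]
  exact ENNReal.one_lt_top

theorem inv_pow_mul_norm_sq_le_berezin {a : ℂ} {k l : ℕ} {M : ℝ} {p w : D}
    (ha : ‖a‖ ^ 2 ≤ M * bergmanDiag w ^ k) (hl : l ≠ 0) :
    (bergmanDiag w ^ (k + l))⁻¹ * ‖a * bergmanKernel D w p ^ l‖ ^ 2 ≤
      M * bergmanDiag p ^ l * berezin p w := by
  have hw := bergmanDiag_pos hD hb w
  have hp := bergmanDiag_pos hD hb p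
  have hβ := berezin_nonneg hD hb p w
  have hM : 0 ≤ M := nonneg_of_mul_nonneg_left ((sq_nonneg _).trans ha) (pow_pos hw k)
  rw [norm_mul, norm_pow, mul_pow, pow_right_comm, norm_sq_bergmanKernel hD hb]
  calc (bergmanDiag w ^ (k + l))⁻¹ *
        (‖a‖ ^ 2 * (berezin p w * (bergmanDiag p * bergmanDiag w)) ^ l)
      ≤ (bergmanDiag w ^ (k + l))⁻¹ * (M * bergmanDiag w ^ k *
        (berezin p w * (bergmanDiag p * bergmanDiag w)) ^ l) := by gcongr
    _ = M * bergmanDiag p ^ l * berezin p w ^ l := by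
        rw [mul_pow, mul_pow, pow_add]
        field_simp
    _ ≤ M * bergmanDiag p ^ l * berezin p w := by
        gcongr
        exact pow_le_of_le_one hβ (berezin_le_one hD hb p w) hl

theorem memLp_mul_bergmanKernel_pow {f : D → ℂ} (hf : IsHolomorphic f) {k : ℕ} {M : ℝ}
    (hM : ∀ w, ‖f w‖ ^ 2 ≤ M * bergmanDiag w ^ k) (p : D) {l : ℕ} (hl : l ≠ 0) :
    MemLp (fun w => f w * bergmanKernel D w p ^ l) 2 (weightVolume D (k + l)) := by
  have hm := measurable_bergmanDiag hD
  have hfK := hf.mul (((isReproducingKernel_bergmanKernel hD).holo p).pow l)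
  have hfKm := hfK.continuous.measurable
  rw [hfK.memLp_two_iff, weightVolume_eq hD hb,
    lintegral_withDensity_eq_lintegral_mul _ (by fun_prop) (by fun_prop)]
  have hle : ∀ w, ENNReal.ofReal (bergmanDiag w ^ (k + l))⁻¹ *
      ‖f w * bergmanKernel D w p ^ l‖ₑ ^ 2 ≤
        ENNReal.ofReal (M * bergmanDiag p ^ l * berezin p w) := fun w => by
    have hw := bergmanDiag_pos hD hb w
    rw [← ofReal_norm, ← ENNReal.ofReal_pow (norm_nonneg _), ← ENNReal.ofReal_mul (by positivity)]
    exact ENNReal.ofReal_le_ofReal (inv_pow_mul_norm_sq_le_berezin hD hb (hM w) hl)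
  exact (lintegral_mono hle).trans_lt
    ((integrable_berezin hD hb p).const_mul _).lintegral_lt_top

theorem memLp_bergmanKernel_pow (p : D) {k : ℕ} (hk : k ≠ 0) :
    MemLp (fun w => bergmanKernel D w p ^ k) 2 (weightVolume D k) := by
  simpa using memLp_mul_bergmanKernel_pow hD hb (isHolomorphic_const (1 : ℂ)) (k := 0) (M := 1)
    (by simp) p hk

end Bergman

/-! ### The reproducing formula in weight `k` -/

section Reproducing

variable {n : ℕ} {D : Set (Fin n → ℂ)}

/-- A bounded homogeneous domain: a bounded domain on which `Aut(D)` acts transitively. -/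
structure IsBoundedHomogeneousDomain (D : Set (Fin n → ℂ)) : Prop where
  isOpen : IsOpen D
  isConnected : IsConnected D
  isBounded : Bornology.IsBounded D
  transitive : ∀ z w : D, ∃ g : Aut D, g • z = w

variable (hD : IsBoundedHomogeneousDomain D)

include hD

theorem diag_eq_const_mul_bergmanDiag_pow {k : ℕ} {L : D → D → ℂ}
    (hL : IsReproducingKernel (weightVolume D k) L) (p z : D) :
    (L z z).re = (L p p).re / bergmanDiag p ^ k * bergmanDiag z ^ k := by
  have hpos := bergmanDiag_pos hD.isOpen hD.isBounded
  obtain ⟨g, rfl⟩ := hD.transitive p z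
  have hμ := quasiInvariant_weightVolume hD.isOpen hD.isBounded k
  rw [← hL.re_diag_smul hD.isOpen hμ g p, ← bergmanDiag_smul hD.isOpen g p]
  have hJ := norm_ne_zero_iff.2 (jacobian_ne_zero hD.isOpen g p)
  have hgp := (hpos (g • p)).ne'
  rw [mul_pow]
  field_simp

theorem exists_isReproducingKernel_pow {k : ℕ} (hk : k ≠ 0) : ∃ c : ℝ, 0 < c ∧
    IsReproducingKernel (weightVolume D k) fun z w => c * bergmanKernel D z w ^ k := by
  have hpos := bergmanDiag_pos hD.isOpen hD.isBounded
  have hE := evalBounded_weightVolume hD.isOpen hD.isBounded k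
  have hK := isReproducingKernel_bergmanKernel hD.isOpen
  obtain ⟨L, hL⟩ := exists_isReproducingKernel hD.isOpen hE
  obtain ⟨p, hp⟩ := hD.isConnected.nonempty
  lift p to D using hp
  have hKp := pow_ne_zero k (bergmanKernel_self_ne_zero hD.isOpen hD.isBounded p)
  have hLp : 0 < (L p p).re := hL.re_diag_pos ((hK.holo p).pow k)
    (memLp_bergmanKernel_pow hD.isOpen hD.isBounded p hk) hKp
  have hdiag : ∀ z, L z z = ((L p p).re / bergmanDiag p ^ k : ℝ) * bergmanKernel D z z ^ k := by
    intro z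
    rw [← hL.ofReal_re_diag, diag_eq_const_mul_bergmanDiag_pow hD hL p, Complex.ofReal_mul,
      Complex.ofReal_pow (bergmanDiag z), ofReal_bergmanDiag hD.isOpen]
  refine ⟨(L p p).re / bergmanDiag p ^ k, div_pos hLp (pow_pos (hpos p) k), ?_⟩
  convert hL using 3 with z w
  exact (hK.eq_const_mul_pow hD.isOpen hD.isConnected.isPreconnected
    (evalBounded_eucVolume hD.isOpen) hE hL hdiag z w).symm

omit hD in
theorem const_mul_integral_bergmanKernel (hD : IsOpen D) (hb : Bornology.IsBounded D) {k : ℕ}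
    {c : ℝ} (hc : c ≠ 0) (hL : IsReproducingKernel (weightVolume D k)
      fun z w => c * bergmanKernel D z w ^ k) (z : D) :
    (c : ℂ) * ∫ w, bergmanKernel D z w ^ k * bergmanKernel D w z ^ k / bergmanKernel D w w ^ k
      ∂(invVolume D) = bergmanKernel D z z ^ k := by
  have hrepr := hL.reproducing _ (hL.holo z) (hL.memLp z) z
  rw [integral_weightVolume hD hb] at hrepr
  refine mul_left_cancel₀ (Complex.ofReal_ne_zero.2 hc) ?_
  rw [hrepr, ← integral_const_mul, ← integral_const_mul]
  refine integral_congr_ae (.of_forall fun w => ?_)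
  simp only [← ofReal_bergmanDiag hD w]
  push_cast
  ring

theorem isReproducingKernel_bergmanConst {k : ℕ} (hk : k ≠ 0) : 0 < bergmanConst D k ∧
    IsReproducingKernel (weightVolume D k) fun z w =>
      bergmanConst D k * bergmanKernel D z w ^ k := by
  obtain ⟨c, hc, hL⟩ := exists_isReproducingKernel_pow hD hk
  have hspec := const_mul_integral_bergmanKernel hD.isOpen hD.isBounded hc.ne' hL
  obtain ⟨p, hp⟩ := hD.isConnected.nonempty
  lift p to D using hp
  have hconst : bergmanConst D k = c := by
    have hKp := pow_ne_zero k (bergmanKernel_self_ne_zero hD.isOpen hD.isBounded p)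
    rw [bergmanConst, dif_pos ⟨c, hspec⟩]
    have hchoose := (Exists.choose_spec (⟨c, hspec⟩ : ∃ c : ℝ, ∀ z : D, (c : ℂ) *
      ∫ w, bergmanKernel D z w ^ k * bergmanKernel D w z ^ k / bergmanKernel D w w ^ k
        ∂(invVolume D) = bergmanKernel D z z ^ k)) p
    rw [← hspec p] at hchoose hKp
    exact_mod_cast mul_right_cancel₀ (right_ne_zero_of_mul hKp) hchoose
  rw [hconst]
  exact ⟨hc, hL⟩

omit hD

theorem integrable_mul_pow_of_mem_Icc {X : Type*} [MeasurableSpace X] {μ : Measure X}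
    {G : X → ℂ} {β : X → ℝ} (hβ : Measurable β) (hβI : ∀ x, β x ∈ Icc 0 1) (hG : Integrable G μ)
    (l : ℕ) : Integrable (fun x => G x * (β x : ℂ) ^ l) μ := by
  refine hG.mul_bdd (c := 1) (Measurable.aestronglyMeasurable (by fun_prop))
    (.of_forall fun x => ?_)
  rw [norm_pow, Complex.norm_real, Real.norm_of_nonneg (hβI x).1]
  exact pow_le_one₀ (hβI x).1 (hβI x).2

theorem integral_mul_one_sub_pow_of_moments {X : Type*} [MeasurableSpace X] {μ : Measure X}
    {G : X → ℂ} {β : X → ℝ} (hβ : Measurable β) (hβI : ∀ x, β x ∈ Icc 0 1) (hG : Integrable G μ)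
    (hmom : ∀ l : ℕ, l ≠ 0 → ∫ x, G x * (β x : ℂ) ^ l ∂μ = 0) (N : ℕ) :
    ∫ x, G x * ((1 - β x : ℝ) : ℂ) ^ N ∂μ = ∫ x, G x ∂μ := by
  have hexp : ∀ x, G x * ((1 - β x : ℝ) : ℂ) ^ N =
      ∑ l ∈ Finset.range (N + 1), G x * (β x : ℂ) ^ l * ((-1) ^ l * N.choose l) := fun x => by
    rw [sub_eq_neg_add, Complex.ofReal_add, add_pow, Finset.mul_sum]
    refine Finset.sum_congr rfl fun l _ => ?_
    rw [Complex.ofReal_neg, Complex.ofReal_one, one_pow, neg_pow]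
    ring
  simp_rw [hexp]
  rw [integral_finsetSum _ fun l _ =>
    (integrable_mul_pow_of_mem_Icc hβ hβI hG l).mul_const _]
  simp_rw [integral_mul_const]
  rw [Finset.sum_eq_single 0 (fun l _ hl => by rw [hmom l hl, zero_mul]) (by simp)]
  simp

theorem integral_eq_zero_of_moments {X : Type*} [MeasurableSpace X] {μ : Measure X} {G : X → ℂ}
    {β : X → ℝ} (hβ : Measurable β) (hβI : ∀ x, β x ∈ Icc 0 1) (hG : Integrable G μ)
    (hG0 : ∀ x, β x = 0 → G x = 0)
    (hmom : ∀ l : ℕ, l ≠ 0 → ∫ x, G x * (β x : ℂ) ^ l ∂μ = 0) : ∫ x, G x ∂μ = 0 := by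
  have hβI' : ∀ x, 1 - β x ∈ Icc 0 1 := fun x => ⟨sub_nonneg.2 (hβI x).2, sub_le_self _ (hβI x).1⟩
  have hlim : Tendsto (fun N : ℕ => ∫ x, G x * ((1 - β x : ℝ) : ℂ) ^ N ∂μ) atTop
      (𝓝 (∫ _, (0 : ℂ) ∂μ)) := by
    refine tendsto_integral_of_dominated_convergence (fun x => ‖G x‖) (fun N => ?_) hG.norm
      (fun N => .of_forall fun x => ?_) (.of_forall fun x => ?_)
    · exact (integrable_mul_pow_of_mem_Icc (by fun_prop) hβI' hG N).aestronglyMeasurable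
    · rw [norm_mul, norm_pow, Complex.norm_real, Real.norm_of_nonneg (hβI' x).1]
      exact mul_le_of_le_one_right (norm_nonneg _) (pow_le_one₀ (hβI' x).1 (hβI' x).2)
    · rcases (hβI x).1.eq_or_lt with hzero | hpos
      · simp [hG0 x hzero.symm]
      · have hlt : ‖((1 - β x : ℝ) : ℂ)‖ < 1 := by
          rw [Complex.norm_real, Real.norm_of_nonneg (hβI' x).1]
          exact sub_lt_self 1 hpos
        simpa using (tendsto_pow_atTop_nhds_zero_of_norm_lt_one hlt).const_mul (G x)
  simp_rw [integral_mul_one_sub_pow_of_moments hβ hβI hG hmom, integral_zero] at hlim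
  exact tendsto_nhds_unique tendsto_const_nhds hlim

/-- The integrand `f(w) 𝒦(p,w)^k 𝒦(w,w)^{-k}` of the reproducing formula of weight `k` at `p`, with
respect to the invariant volume. -/
noncomputable def reproducingIntegrand (k : ℕ) (f : D → ℂ) (p w : D) : ℂ :=
  f w * bergmanKernel D p w ^ k * ((bergmanDiag w ^ k)⁻¹ : ℝ)

theorem berezin_mem_Icc (hD : IsOpen D) (hb : Bornology.IsBounded D) (p w : D) :
    berezin p w ∈ Icc 0 1 :=
  ⟨berezin_nonneg hD hb p w, berezin_le_one hD hb p w⟩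

theorem ofReal_berezin_mul_bergmanDiag (hD : IsOpen D) (hb : Bornology.IsBounded D) (p w : D) :
    (berezin p w : ℂ) * bergmanDiag p =
      bergmanKernel D w p * bergmanKernel D p w * (bergmanDiag w : ℂ)⁻¹ := by
  have hw := Complex.ofReal_ne_zero.2 (bergmanDiag_pos hD hb w).ne'
  rw [(isReproducingKernel_bergmanKernel hD).hermitian p w, Complex.mul_conj,
    Complex.normSq_eq_norm_sq, norm_sq_bergmanKernel hD hb]
  push_cast
  field_simp

variable {f : D → ℂ} {k : ℕ} {M : ℝ} (hM : ∀ w, ‖f w‖ ^ 2 ≤ M * bergmanDiag w ^ k)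

include hM

theorem norm_reproducingIntegrand_le (hD : IsOpen D) (hb : Bornology.IsBounded D) (hk : 2 ≤ k)
    (p w : D) :
    ‖reproducingIntegrand k f p w‖ ≤ √(M * bergmanDiag p ^ k) * berezin p w := by
  have hp := bergmanDiag_pos hD hb p
  have hw := bergmanDiag_pos hD hb w
  have hβ := berezin_mem_Icc hD hb p w
  have hM0 : 0 ≤ M := nonneg_of_mul_nonneg_left ((sq_nonneg _).trans (hM p)) (pow_pos hp k)
  refine le_of_sq_le_sq ?_ (mul_nonneg (Real.sqrt_nonneg _) hβ.1)
  rw [reproducingIntegrand, mul_pow (√_), Real.sq_sqrt (by positivity), norm_mul, norm_mul,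
    norm_pow, mul_pow, mul_pow, (isReproducingKernel_bergmanKernel hD).norm_comm p w,
    pow_right_comm, norm_sq_bergmanKernel hD hb, Complex.norm_real,
    Real.norm_of_nonneg (by positivity)]
  have hβ0 := hβ.1
  calc ‖f w‖ ^ 2 * (berezin p w * (bergmanDiag p * bergmanDiag w)) ^ k *
        (bergmanDiag w ^ k)⁻¹ ^ 2
      ≤ (M * bergmanDiag w ^ k) * (berezin p w * (bergmanDiag p * bergmanDiag w)) ^ k *
        (bergmanDiag w ^ k)⁻¹ ^ 2 := by gcongr; exact hM w
    _ = M * bergmanDiag p ^ k * berezin p w ^ k := by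
        rw [mul_pow, mul_pow]
        field_simp
    _ ≤ M * bergmanDiag p ^ k * berezin p w ^ 2 := by
        gcongr ?_ * ?_
        exact pow_le_pow_of_le_one hβ0 hβ.2 hk

theorem integrable_reproducingIntegrand (hD : IsOpen D) (hb : Bornology.IsBounded D) (hk : 2 ≤ k)
    (hf : IsHolomorphic f) (p : D) : Integrable (reproducingIntegrand k f p) (invVolume D) := by
  have hm := measurable_bergmanDiag hD
  have hK := isReproducingKernel_bergmanKernel hD
  have hfm := hf.continuous.measurable
  have hKm : Measurable (bergmanKernel D p) := by
    rw [funext (hK.hermitian p)]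
    exact (Complex.continuous_conj.comp (hK.holo p).continuous).measurable
  refine ((integrable_berezin hD hb p).const_mul _).mono' ?_
    (.of_forall (norm_reproducingIntegrand_le hM hD hb hk p))
  unfold reproducingIntegrand
  exact Measurable.aestronglyMeasurable (by fun_prop)

include hD in
theorem bergmanConst_mul_moment (hf : IsHolomorphic f) (p : D) {l : ℕ} (hl : l ≠ 0) :
    bergmanConst D (k + l) * ∫ w, reproducingIntegrand k f p w * (berezin p w : ℂ) ^ l
      ∂(invVolume D) = f p := by
  have hp := Complex.ofReal_ne_zero.2 (bergmanDiag_pos hD.isOpen hD.isBounded p).ne'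
  have hK := isReproducingKernel_bergmanKernel hD.isOpen
  have hL := (isReproducingKernel_bergmanConst hD (k := k + l) (by omega)).2
  have hrepr := hL.reproducing _ (hf.mul ((hK.holo p).pow l))
    (memLp_mul_bergmanKernel_pow hD.isOpen hD.isBounded hf hM p hl) p
  rw [integral_weightVolume hD.isOpen hD.isBounded, ← ofReal_bergmanDiag hD.isOpen] at hrepr
  refine mul_right_cancel₀ (pow_ne_zero l hp) ?_
  rw [hrepr, ← integral_const_mul, ← integral_mul_const]
  refine integral_congr_ae (.of_forall fun w => ?_)
  simp only [reproducingIntegrand]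
  rw [mul_assoc, mul_assoc, ← mul_pow, ofReal_berezin_mul_bergmanDiag hD.isOpen hD.isBounded]
  push_cast
  rw [mul_pow, mul_pow, pow_add, pow_add, mul_inv, inv_pow]
  ring

include hD in
theorem integral_reproducingIntegrand_eq_zero (hk : 2 ≤ k) (hf : IsHolomorphic f) {p : D}
    (hfp : f p = 0) : ∫ w, reproducingIntegrand k f p w ∂(invVolume D) = 0 := by
  refine integral_eq_zero_of_moments (measurable_berezin hD.isOpen p)
    (berezin_mem_Icc hD.isOpen hD.isBounded p)
    (integrable_reproducingIntegrand hM hD.isOpen hD.isBounded hk hf p) (fun w hw => ?_)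
    fun l hl => ?_
  · have hnorm := norm_reproducingIntegrand_le hM hD.isOpen hD.isBounded hk p w
    rwa [hw, mul_zero, norm_le_zero_iff] at hnorm
  · have hmoment := bergmanConst_mul_moment hD hM hf p hl
    have hpos := (isReproducingKernel_bergmanConst hD (k := k + l) (by omega)).1
    rw [hfp] at hmoment
    exact (mul_eq_zero.1 hmoment).resolve_left (Complex.ofReal_ne_zero.2 hpos.ne')

omit hM

theorem norm_sq_bergmanKernel_pow_le (hD : IsOpen D) (p w : D) :
    ‖bergmanKernel D w p ^ k‖ ^ 2 ≤ bergmanDiag p ^ k * bergmanDiag w ^ k := by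
  rw [norm_pow, pow_right_comm, ← mul_pow, mul_comm (bergmanDiag p)]
  gcongr
  exact (isReproducingKernel_bergmanKernel hD).norm_sq_le w p

include hD in
theorem bergmanConst_mul_integral_bergmanKernel_pow (hk : k ≠ 0) (p : D) :
    bergmanConst D k * ∫ w, reproducingIntegrand k (fun w => bergmanKernel D w p ^ k) p w
      ∂(invVolume D) = bergmanKernel D p p ^ k := by
  have hK := isReproducingKernel_bergmanKernel hD.isOpen
  have hrepr := (isReproducingKernel_bergmanConst hD hk).2.reproducing _ ((hK.holo p).pow k)
    (memLp_bergmanKernel_pow hD.isOpen hD.isBounded p hk) p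
  rw [hrepr, integral_weightVolume hD.isOpen hD.isBounded, ← integral_const_mul]
  refine integral_congr_ae (.of_forall fun w => ?_)
  simp only [reproducingIntegrand]
  ring

include hD hM in
theorem bergmanConst_mul_integral_reproducingIntegrand (hk : 2 ≤ k) (hf : IsHolomorphic f)
    (p : D) : bergmanConst D k * ∫ w, reproducingIntegrand k f p w ∂(invVolume D) = f p := by
  have hu := ((isReproducingKernel_bergmanKernel hD.isOpen).holo p).pow k
  have huM := norm_sq_bergmanKernel_pow_le (k := k) hD.isOpen p
  have hup := pow_ne_zero k (bergmanKernel_self_ne_zero hD.isOpen hD.isBounded p)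
  set u : D → ℂ := fun w => bergmanKernel D w p ^ k
  replace hup : u p ≠ 0 := hup
  -- Subtracting the multiple of `𝒦(·,p)^k` with the same value at `p` reduces to `f p = 0`.
  set a : ℂ := f p / u p
  have hdiffM : ∀ w, ‖f w - a * u w‖ ^ 2 ≤
      2 * (M + ‖a‖ ^ 2 * bergmanDiag p ^ k) * bergmanDiag w ^ k := fun w => by
    calc ‖f w - a * u w‖ ^ 2 ≤ (‖f w‖ + ‖a‖ * ‖u w‖) ^ 2 := by
          gcongr
          exact (norm_sub_le _ _).trans_eq (by rw [norm_mul])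
      _ ≤ 2 * (‖f w‖ ^ 2 + ‖a‖ ^ 2 * ‖u w‖ ^ 2) := by
          rw [← mul_pow]
          exact add_sq_le
      _ ≤ 2 * (M * bergmanDiag w ^ k + ‖a‖ ^ 2 * (bergmanDiag p ^ k * bergmanDiag w ^ k)) := by
          gcongr
          exacts [hM w, huM w]
      _ = 2 * (M + ‖a‖ ^ 2 * bergmanDiag p ^ k) * bergmanDiag w ^ k := by ring
  have hzero := integral_reproducingIntegrand_eq_zero hD hdiffM hk
    (hf.sub ((isHolomorphic_const a).mul hu)) (sub_eq_zero.2 (div_mul_cancel₀ (f p) hup).symm)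
  have hsplit : ∀ w, reproducingIntegrand k (fun w => f w - a * u w) p w =
      reproducingIntegrand k f p w - a * reproducingIntegrand k u p w := fun w => by
    simp only [reproducingIntegrand]
    ring
  simp_rw [hsplit] at hzero
  rw [integral_sub (integrable_reproducingIntegrand hM hD.isOpen hD.isBounded hk hf p)
    ((integrable_reproducingIntegrand huM hD.isOpen hD.isBounded hk hu p).const_mul a),
    integral_const_mul, sub_eq_zero] at hzero
  rw [hzero, mul_left_comm, bergmanConst_mul_integral_bergmanKernel_pow hD (by omega)]
  exact div_mul_cancel₀ (f p) hup

end Reproducing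

/-! ### Proper discontinuity -/

section Caratheodory

variable {n : ℕ} {D : Set (Fin n → ℂ)} {ε δ : ℝ} {x y z w : D}

/-- The Carathéodory pseudo-distance of `z` and `w` is at most `ε`; it is measured here in the
Euclidean metric of the closed unit disc rather than in the hyperbolic one. Automorphisms of `D`
preserve this relation. -/
def CaratheodoryClose (ε : ℝ) (z w : D) : Prop :=
  ∀ f : D → ℂ, IsHolomorphic f → (∀ x, ‖f x‖ ≤ 1) → ‖f z - f w‖ ≤ ε

namespace CaratheodoryClose

theorem symm (h : CaratheodoryClose ε z w) : CaratheodoryClose ε w z :=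
  fun f hf hb => by rw [norm_sub_rev]; exact h f hf hb

theorem trans (h : CaratheodoryClose ε x y) (h' : CaratheodoryClose δ y z) :
    CaratheodoryClose (ε + δ) x z := fun f hf hb =>
  (norm_sub_le_norm_sub_add_norm_sub _ (f y) _).trans (add_le_add (h f hf hb) (h' f hf hb))

theorem smul (h : CaratheodoryClose ε z w) (g : Aut D) :
    CaratheodoryClose ε (g • z) (g • w) := fun f hf hb =>
  h (fun x => f (g • x)) (hf.comp_smul g) fun _ => hb _

end CaratheodoryClose

theorem exists_dist_le_of_caratheodoryClose (hb : Bornology.IsBounded D) : ∃ R > 0,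
    ∀ {ε : ℝ} {z w : D}, 0 ≤ ε → CaratheodoryClose ε z w → dist z w ≤ R * ε := by
  obtain ⟨R, hR, hRD⟩ := hb.exists_pos_norm_le
  refine ⟨R, hR, fun {ε z w} hε h => ?_⟩
  rw [Subtype.dist_eq, dist_pi_le_iff (by positivity)]
  intro i
  have hcoord : IsHolomorphic fun x : D => (R : ℂ)⁻¹ * (x : Fin n → ℂ) i :=
    isHolomorphic_of_eqOn (u := fun x => (R : ℂ)⁻¹ * x i) (by fun_prop) fun x => rfl
  have hdiff := h _ hcoord fun x => by
    rw [norm_mul, norm_inv, Complex.norm_real, Real.norm_of_nonneg hR.le, inv_mul_le_iff₀ hR,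
      mul_one]
    exact (norm_le_pi_norm _ i).trans (hRD _ x.2)
  rw [← mul_sub, norm_mul, norm_inv, Complex.norm_real, Real.norm_of_nonneg hR.le,
    inv_mul_le_iff₀ hR] at hdiff
  rwa [dist_eq_norm]

theorem eventually_caratheodoryClose (hD : IsOpen D) (z : D) (hε : 0 < ε) :
    ∀ᶠ w in 𝓝 z, CaratheodoryClose ε w z := by
  obtain ⟨r, hr, hrD⟩ := Metric.isOpen_iff.1 hD z z.2
  have hnear : ∀ᶠ w : D in 𝓝 z, dist w z < min r (ε * r / 2) :=
    ball_mem_nhds z (lt_min hr (by positivity))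
  filter_upwards [hnear] with w hw f hf hb
  obtain ⟨hwr, hwε⟩ := lt_min_iff.1 hw
  have hmaps : MapsTo (Function.extend Subtype.val f 0) (ball (z : Fin n → ℂ) r)
      (closedBall (Function.extend Subtype.val f 0 (z : Fin n → ℂ)) 2) := by
    intro y hy
    lift y to D using hrD hy
    rw [mem_closedBall, extend_coe, extend_coe, dist_eq_norm]
    linarith [norm_sub_le (f y) (f z), hb y, hb z]
  have hschwarz := Complex.dist_le_div_mul_dist_of_mapsTo_ball (DifferentiableOn.mono hf hrD) hmaps
    (show (w : Fin n → ℂ) ∈ ball (z : Fin n → ℂ) r from hwr)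
  rw [extend_coe, extend_coe, dist_eq_norm] at hschwarz
  refine hschwarz.trans ?_
  rw [Subtype.dist_eq] at hwε
  rw [div_mul_eq_mul_div, div_le_iff₀ hr]
  linarith

end Caratheodory

section Discontinuity

variable {n : ℕ} {D : Set (Fin n → ℂ)}

instance (Γ : Subgroup (Aut D)) : ContinuousConstSMul Γ D :=
  ⟨fun γ => continuous_aut_smul (γ : Aut D)⟩

theorem isInducing_toContinuousMap (Γ : Subgroup (Aut D)) :
    Topology.IsInducing fun γ : Γ => Aut.toContinuousMap (γ : Aut D) :=
  (Topology.IsInducing.mk rfl : Topology.IsInducing (Aut.toContinuousMap (D := D))).comp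
    Topology.IsInducing.subtypeVal

theorem countable_of_discrete (hD : IsOpen D) (Γ : Subgroup (Aut D)) [DiscreteTopology Γ] :
    Countable Γ := by
  have : LocallyCompactSpace D := hD.locallyCompactSpace
  have : SecondCountableTopology Γ := (isInducing_toContinuousMap Γ).secondCountableTopology
  exact countable_of_Lindelof_of_discrete

theorem exists_isCompact_caratheodoryClose (hD : IsBoundedHomogeneousDomain D) :
    ∃ ε > 0, ∀ z : D, ∃ C : Set D, IsCompact C ∧ ∀ w, CaratheodoryClose ε w z → w ∈ C := by
  obtain ⟨p, hp⟩ := hD.isConnected.nonempty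
  lift p to D using hp
  obtain ⟨R, hR, hdist⟩ := exists_dist_le_of_caratheodoryClose hD.isBounded
  obtain ⟨r, hr, -, hc⟩ := exists_isCompact_closedBall hD.isOpen p
  refine ⟨r / R, by positivity, fun z => ?_⟩
  obtain ⟨g, rfl⟩ := hD.transitive p z
  refine ⟨_, hc.image (continuous_aut_smul g), fun w hw => ⟨g⁻¹ • w, ?_, smul_inv_smul g w⟩⟩
  have hclose : CaratheodoryClose (r / R) (g⁻¹ • w) p := by
    simpa only [inv_smul_smul] using hw.smul g⁻¹
  have := hdist (by positivity) hclose
  rwa [mul_div_cancel₀ _ hR.ne'] at this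

theorem exists_tendsto_smul (hD : IsBoundedHomogeneousDomain D) (𝒰 : Ultrafilter (Aut D)) {p q : D}
    (hp : Tendsto (fun g : Aut D => g • p) 𝒰 (𝓝 q)) (z : D) :
    ∃ y : D, Tendsto (fun g : Aut D => g • z) 𝒰 (𝓝 y) := by
  obtain ⟨ε, hε, hcpt⟩ := exists_isCompact_caratheodoryClose hD
  have : PreconnectedSpace D := isPreconnected_iff_preconnectedSpace.1 hD.isConnected.isPreconnected
  set S : Set D := {z : D | ∃ y : D, Tendsto (fun g : Aut D => g • z) 𝒰 (𝓝 y)}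
  have hstep : ∀ z w : D, z ∈ S → CaratheodoryClose (ε / 2) w z → w ∈ S := by
    rintro z w ⟨y, hy⟩ hwz
    obtain ⟨C, hC, hCy⟩ := hcpt y
    have hmem : ∀ᶠ g : Aut D in 𝒰, g • w ∈ C := by
      filter_upwards [hy.eventually (eventually_caratheodoryClose hD.isOpen y (half_pos hε))]
        with g hg
      exact hCy _ (by simpa using (hwz.smul g).trans hg)
    obtain ⟨y', -, hy'⟩ := hC.ultrafilter_le_nhds (𝒰.map fun g => g • w) (le_principal_iff.2 hmem)
    exact ⟨y', hy'⟩
  have hclopen : IsClopen S := by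
    refine ⟨isOpen_compl_iff.1 (isOpen_iff_mem_nhds.2 fun z hz => ?_),
      isOpen_iff_mem_nhds.2 fun z hz => ?_⟩
    · filter_upwards [eventually_caratheodoryClose hD.isOpen z (half_pos hε)] with w hw hwS
      exact hz (hstep w z hwS hw.symm)
    · filter_upwards [eventually_caratheodoryClose hD.isOpen z (half_pos hε)] with w hw
      exact hstep z w hz hw
  exact eq_univ_iff_forall.1 (hclopen.eq_univ ⟨p, q, hp⟩) z

theorem tendsto_inv_mul_nhds_one (hD : IsOpen D) (hb : Bornology.IsBounded D)
    {Γ : Subgroup (Aut D)} {l : Filter Γ}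
    (h : ∀ z : D, ∃ y : D, Tendsto (fun g : Γ => g • z) l (𝓝 y)) :
    Tendsto (fun q : Γ × Γ => q.1⁻¹ * q.2) (l ×ˢ l) (𝓝 1) := by
  have : LocallyCompactSpace D := hD.locallyCompactSpace
  rw [(isInducing_toContinuousMap Γ).tendsto_nhds_iff,
    ContinuousMap.tendsto_iff_tendstoLocallyUniformly, Metric.tendstoLocallyUniformly_iff]
  intro ε hε z
  obtain ⟨R, hR, hdist⟩ := exists_dist_le_of_caratheodoryClose hb
  obtain ⟨y, hy⟩ := h z
  set δ := ε / (8 * R)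
  have hδ : 0 < δ := by positivity
  have hδε : R * (δ + (δ + (δ + δ))) = ε / 2 := by
    simp only [δ]
    field_simp
    ring
  refine ⟨_, eventually_caratheodoryClose hD z hδ, ?_⟩
  have hy' := hy.eventually (eventually_caratheodoryClose hD y hδ)
  filter_upwards [hy'.prod_mk hy'] with q ⟨hq₁, hq₂⟩ x hx
  have hz : CaratheodoryClose (δ + δ) ((q.1⁻¹ * q.2) • z) z := by
    simpa only [mul_smul, ← Subgroup.smul_def, inv_smul_smul] using
      (hq₂.trans hq₁.symm).smul ((q.1⁻¹ : Γ) : Aut D)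
  have hx' : CaratheodoryClose δ ((q.1⁻¹ * q.2) • x) ((q.1⁻¹ * q.2) • z) :=
    CaratheodoryClose.smul hx ((q.1⁻¹ * q.2 : Γ) : Aut D)
  have hclose := hdist (by positivity) (CaratheodoryClose.trans hx (hx'.trans hz).symm)
  rw [show Aut.toContinuousMap ((1 : Γ) : Aut D) x = x from one_smul (Aut D) x]
  exact (hclose.trans_eq hδε).trans_lt (half_lt_self hε)

theorem exists_subsingleton_mem_of_tendsto_inv_mul {G : Type*} [Group G] [TopologicalSpace G]
    [DiscreteTopology G] {l : Filter G}
    (h : Tendsto (fun q : G × G => q.1⁻¹ * q.2) (l ×ˢ l) (𝓝 1)) : ∃ T ∈ l, T.Subsingleton := by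
  have hone : ∀ᶠ q : G × G in l ×ˢ l, q.1⁻¹ * q.2 = 1 :=
    h.eventually (p := fun g => g = 1) ((isOpen_discrete {(1 : G)}).mem_nhds rfl)
  obtain ⟨T, hT, hTT⟩ := Filter.mem_prod_same_iff.1 hone
  exact ⟨T, hT, fun a ha b hb => inv_mul_eq_one.1 (hTT (mk_mem_prod ha hb))⟩

theorem properlyDiscontinuousSMul_of_discrete (hD : IsBoundedHomogeneousDomain D)
    (Γ : Subgroup (Aut D)) [DiscreteTopology Γ] : ProperlyDiscontinuousSMul Γ D := by
  obtain ⟨ε, hε, hcpt⟩ := exists_isCompact_caratheodoryClose hD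
  refine ⟨fun {K L} hK hL => ?_⟩
  by_contra hinf
  set S := {γ : Γ | ((γ • ·) '' K ∩ L).Nonempty}
  have : NeBot (cofinite ⊓ 𝓟 S) := cofinite_inf_principal_neBot_iff.2 hinf
  set 𝒰 := Ultrafilter.of (cofinite ⊓ 𝓟 S)
  have hle : (𝒰 : Filter Γ) ≤ cofinite ⊓ 𝓟 S := Ultrafilter.of_le _
  have hS : S ∈ (𝒰 : Filter Γ) := hle (mem_inf_of_right (mem_principal_self S))
  have hwit : ∀ γ ∈ S, ∃ z ∈ K, γ • z ∈ L := by
    rintro γ ⟨-, ⟨z, hz, rfl⟩, hγz⟩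
    exact ⟨z, hz, hγz⟩
  have : Nonempty D := hD.isConnected.nonempty.to_subtype
  choose! ζ hζK hζL using hwit
  have hK' : ∀ᶠ γ in (𝒰 : Filter Γ), ζ γ ∈ K := mem_of_superset hS hζK
  have hL' : ∀ᶠ γ in (𝒰 : Filter Γ), γ • ζ γ ∈ L := mem_of_superset hS hζL
  obtain ⟨p, -, hp⟩ := hK.ultrafilter_le_nhds (𝒰.map ζ) (le_principal_iff.2 hK')
  obtain ⟨q, -, hq⟩ := hL.ultrafilter_le_nhds (𝒰.map fun γ => γ • ζ γ) (le_principal_iff.2 hL')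
  obtain ⟨C, hC, hCq⟩ := hcpt q
  have hpC : ∀ᶠ γ in (𝒰 : Filter Γ), γ • p ∈ C := by
    filter_upwards [hp (eventually_caratheodoryClose hD.isOpen p (half_pos hε)),
      hq (eventually_caratheodoryClose hD.isOpen q (half_pos hε))] with γ hγp hγq
    refine hCq _ ?_
    have hγp' : CaratheodoryClose (ε / 2) (γ • p) (γ • ζ γ) :=
      (CaratheodoryClose.symm hγp).smul (γ : Aut D)
    simpa using hγp'.trans hγq
  obtain ⟨y, -, hy⟩ := hC.ultrafilter_le_nhds (𝒰.map fun γ => γ • p) (le_principal_iff.2 hpC)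
  obtain ⟨T, hT, hTs⟩ := exists_subsingleton_mem_of_tendsto_inv_mul
    (tendsto_inv_mul_nhds_one hD.isOpen hD.isBounded fun z =>
      exists_tendsto_smul hD (𝒰.map Subtype.val) (p := p) hy z)
  exact 𝒰.compl_notMem_iff.2 hT (hle (mem_inf_of_left hTs.finite.compl_mem_cofinite))

end Discontinuity

/-! ### Fundamental domains -/

section ProperlyDiscontinuous

variable {G X : Type*} [Group G] [MulAction G X] [TopologicalSpace X]
  [ProperlyDiscontinuousSMul G X] [ContinuousConstSMul G X] [T2Space X] [MeasurableSpace X]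
  [BorelSpace X] [Countable G]

theorem exists_tsum_setLIntegral_le {A : Set X} (hA : IsCompact A) {μ : Measure X} {u : X → ℝ≥0∞}
    (hu : AEMeasurable u μ) : ∃ N : ℕ,
      ∑' g : G, ∫⁻ z in (fun z => g⁻¹ • z) ⁻¹' A, u z ∂μ ≤ N * ∫⁻ z, u z ∂μ := by
  have hfin : {g : G | ((g • ·) '' A ∩ A).Nonempty}.Finite := finite_disjoint_inter_image hA hA
  have hm (g : G) : MeasurableSet ((fun z => g⁻¹ • z) ⁻¹' A) :=
    measurable_const_smul g⁻¹ hA.measurableSet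
  have hoverlap (z : X) : {g : G | g⁻¹ • z ∈ A}.encard ≤ hfin.toFinset.card := by
    rw [← hfin.encard_eq_coe_toFinset_card]
    rcases {g : G | g⁻¹ • z ∈ A}.eq_empty_or_nonempty with h | ⟨h, hh⟩
    · simp [h]
    · refine encard_le_encard_of_injOn (f := fun g => g⁻¹ * h) (fun g hg => ?_)
        (fun a _ b _ hab => inv_injective (mul_right_cancel hab))
      exact ⟨g⁻¹ • z, ⟨h⁻¹ • z, hh, by simp only [mul_smul, smul_inv_smul]⟩, hg⟩
  refine ⟨hfin.toFinset.card, ?_⟩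
  calc ∑' g : G, ∫⁻ z in (fun z => g⁻¹ • z) ⁻¹' A, u z ∂μ
      = ∫⁻ z, ∑' g : G, ((fun z => g⁻¹ • z) ⁻¹' A).indicator u z ∂μ := by
        rw [lintegral_tsum fun g => hu.indicator (hm g)]
        exact tsum_congr fun g => (lintegral_indicator (hm g) u).symm
    _ ≤ ∫⁻ z, hfin.toFinset.card * u z ∂μ := by
        refine lintegral_mono fun z => ?_
        have hind : ∑' g : G, ((fun z => g⁻¹ • z) ⁻¹' A).indicator u z =
            {g : G | g⁻¹ • z ∈ A}.encard * u z := by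
          rw [← ENNReal.tsum_set_const, tsum_subtype _ fun _ => u z]
          rfl
        rw [hind]
        gcongr
        exact (ENat.toENNReal_mono (hoverlap z)).trans_eq (ENat.toENNReal_coe _)
    _ = hfin.toFinset.card * ∫⁻ z, u z ∂μ := lintegral_const_mul' _ _ (ENNReal.natCast_ne_top _)

end ProperlyDiscontinuous

section FundamentalDomain

variable {G X : Type*} [Group G] [MulAction G X]

/-- The union of the translates of `U`. -/
def saturation (G : Type*) [Group G] [MulAction G X] (U : Set X) : Set X :=
  ⋃ g : G, (fun z => g • z) ⁻¹' U

theorem mem_saturation {U : Set X} {z : X} : z ∈ saturation G U ↔ ∃ g : G, g • z ∈ U := mem_iUnion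

theorem smul_mem_saturation_iff {U : Set X} (g : G) {z : X} :
    g • z ∈ saturation G U ↔ z ∈ saturation G U := by
  simp only [mem_saturation, smul_smul]
  exact ⟨fun ⟨h, hh⟩ => ⟨h * g, hh⟩, fun ⟨h, hh⟩ => ⟨h * g⁻¹, by rwa [inv_mul_cancel_right]⟩⟩

theorem subset_saturation (U : Set X) : U ⊆ saturation G U :=
  fun z hz => mem_saturation.2 ⟨1, by rwa [one_smul]⟩

theorem isFundamentalDomain_iUnion_diff [MeasurableSpace X] [MeasurableConstSMul G X] [Countable G]
    {μ : Measure X} {U : ℕ → Set X} (hU : ∀ i, MeasurableSet (U i))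
    (hfree : ∀ i, ∀ g : G, ∀ z ∈ U i, g • z ∈ U i → g = 1) (hcov : ∀ᵐ z ∂μ, ∃ i, z ∈ U i) :
    IsFundamentalDomain G (⋃ i, U i \ ⋃ j < i, saturation G (U j)) μ where
  nullMeasurableSet := by
    have hsat (i : ℕ) : MeasurableSet (saturation G (U i)) :=
      MeasurableSet.iUnion fun g => measurable_const_smul g (hU i)
    exact (MeasurableSet.iUnion fun i => (hU i).diff
      (MeasurableSet.iUnion fun j => MeasurableSet.iUnion fun _ => hsat j)).nullMeasurableSet
  ae_covers := by
    filter_upwards [hcov] with z ⟨i, hi⟩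
    classical
    have hex : ∃ i, z ∈ saturation G (U i) := ⟨i, subset_saturation _ hi⟩
    obtain ⟨g, hg⟩ := mem_saturation.1 (Nat.find_spec hex)
    refine ⟨g, mem_iUnion.2 ⟨_, hg, fun h => ?_⟩⟩
    obtain ⟨j, hj, hjz⟩ := mem_iUnion₂.1 h
    exact Nat.find_min hex hj ((smul_mem_saturation_iff g).1 hjz)
  aedisjoint g h hgh := by
    refine (Set.disjoint_left.2 ?_).aedisjoint
    rintro _ ⟨x, hx, rfl⟩ ⟨y, hy, hxy⟩
    obtain ⟨i, hxi, hxi'⟩ := mem_iUnion.1 hx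
    obtain ⟨j, hyj, hyj'⟩ := mem_iUnion.1 hy
    have hyx : y = (h⁻¹ * g) • x := by rw [mul_smul, eq_inv_smul_iff]; exact hxy
    subst hyx
    rcases lt_trichotomy i j with hij | rfl | hji
    · exact hyj' (mem_iUnion₂.2 ⟨i, hij, (smul_mem_saturation_iff _).2 (subset_saturation _ hxi)⟩)
    · exact hgh (inv_mul_eq_one.1 (hfree i _ x hxi hyj)).symm
    · exact hxi' (mem_iUnion₂.2 ⟨j, hji, (smul_mem_saturation_iff _).1 (subset_saturation _ hyj)⟩)

theorem exists_isFundamentalDomain_of_ae_stabilizer_eq_bot [TopologicalSpace X]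
    [SecondCountableTopology X] [T2Space X] [LocallyCompactSpace X] [MeasurableSpace X]
    [BorelSpace X] [ContinuousConstSMul G X] [ProperlyDiscontinuousSMul G X] [Countable G]
    {μ : Measure X} (hμ : ∀ᵐ z ∂μ, ∀ g : G, g • z = z → g = 1) :
    ∃ 𝓕 : Set X, IsFundamentalDomain G 𝓕 μ := by
  set B : Set (Set X) :=
    {U ∈ TopologicalSpace.countableBasis X | ∀ g : G, ∀ z ∈ U, g • z ∈ U → g = 1}
  have hBc : (insert ∅ B).Countable :=
    ((TopologicalSpace.countable_countableBasis X).mono (sep_subset _ _)).insert ∅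
  obtain ⟨U, hU⟩ := hBc.exists_eq_range (insert_nonempty _ _)
  have hmem (i : ℕ) : U i = ∅ ∨ U i ∈ B := by
    rw [← mem_insert_iff, hU]
    exact mem_range_self i
  refine ⟨_, isFundamentalDomain_iUnion_diff (U := U) (fun i => ?_) (fun i => ?_) ?_⟩
  · rcases hmem i with h | h
    · rw [h]
      exact MeasurableSet.empty
    · exact (TopologicalSpace.isOpen_of_mem_countableBasis h.1).measurableSet
  · rcases hmem i with h | h
    · simp [h]
    · exact h.2
  · filter_upwards [hμ] with z hz
    obtain ⟨V, hV, hVz⟩ := ProperlyDiscontinuousSMul.exists_nhds_image_smul_eq_self G z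
    obtain ⟨W, hW, hzW, hWV⟩ := (TopologicalSpace.isBasis_countableBasis X).mem_nhds_iff.1 hV
    have hWB : W ∈ insert ∅ B := mem_insert_of_mem _
      ⟨hW, fun g x hx hgx => hz g (hVz g ⟨_, mem_image_of_mem _ (hWV hx), hWV hgx⟩)⟩
    rw [hU] at hWB
    obtain ⟨i, rfl⟩ := hWB
    exact ⟨i, hzW⟩

end FundamentalDomain

section AutomorphismGroup

variable {n : ℕ} {D : Set (Fin n → ℂ)}

theorem ae_smul_ne (hD : IsOpen D) (hc : IsPreconnected D) {g : Aut D} (hg : g ≠ 1) :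
    ∀ᵐ z ∂eucVolume D, g • z ≠ z := by
  obtain ⟨a, ha⟩ : ∃ a : D, g • a ≠ a := by
    by_contra! h
    exact hg (Subtype.ext (Equiv.ext h))
  obtain ⟨i, hi⟩ : ∃ i, ((g • a : D) : Fin n → ℂ) i ≠ (a : Fin n → ℂ) i :=
    Function.ne_iff.1 fun h => ha (Subtype.ext h)
  have hhol : DifferentiableOn ℂ (fun z => autExt g z i - z i) D :=
    (differentiableOn_pi.1 (isHolomorphic_smul g) i).sub (by fun_prop)
  have hnull := measure_zeros_eq_zero (μ := volume) hD hc hhol a.2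
    (by rw [autExt_coe]; exact sub_ne_zero.2 hi)
  rw [ae_iff, eucVolume, (MeasurableEmbedding.subtype_coe hD.measurableSet).comap_apply]
  refine measure_mono_null ?_ hnull
  rintro _ ⟨z, hz, rfl⟩
  have hz' : g • z = z := not_not.1 hz
  exact ⟨z.2, by simp [autExt_coe, hz']⟩

theorem exists_isFundamentalDomain (hD : IsBoundedHomogeneousDomain D) {Γ : Subgroup (Aut D)}
    [DiscreteTopology Γ] : ∃ 𝓕 : Set D, IsFundamentalDomain Γ 𝓕 (invVolume D) := by
  have := countable_of_discrete hD.isOpen Γ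
  have := properlyDiscontinuousSMul_of_discrete hD Γ
  have : LocallyCompactSpace D := hD.isOpen.locallyCompactSpace
  refine exists_isFundamentalDomain_of_ae_stabilizer_eq_bot
    ((withDensity_absolutelyContinuous _ _).ae_le (ae_all_iff.2 fun γ => ?_))
  by_cases hγ : γ = 1
  · exact Eventually.of_forall fun _ _ => hγ
  · filter_upwards [ae_smul_ne hD.isOpen hD.isConnected.isPreconnected
      (g := (γ : Aut D)) (by simpa using hγ)] with z hz h
    exact (hz h).elim

end AutomorphismGroup

/-! ### Poincaré series -/

section Series

variable {n m : ℕ} {D : Set (Fin n → ℂ)} {Γ : Subgroup (Aut D)}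

theorem norm_slash_bergmanKernel_sq_le (hD : IsOpen D) (p : D) (g : Aut D) (z : D) :
    ‖slash 1 g (fun w => bergmanKernel D w p) z‖ ^ 2 ≤ bergmanDiag p * bergmanDiag z := by
  rw [slash, pow_one, norm_mul, mul_pow, ← bergmanDiag_smul hD g z, ← mul_assoc]
  gcongr
  rw [mul_comm]
  exact (isReproducingKernel_bergmanKernel hD).norm_sq_le _ _

theorem exists_summable_norm_slash_bergmanKernel_sq_le (hD : IsBoundedHomogeneousDomain D)
    [DiscreteTopology Γ] (p : D) {A : Set D} (hA : IsCompact A) :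
    ∃ u : Γ → ℝ, Summable u ∧ ∀ γ : Γ, ∀ z ∈ A,
      ‖slash 1 (γ : Aut D) (fun w => bergmanKernel D w p) z‖ ^ 2 ≤ u γ := by
  have := countable_of_discrete hD.isOpen Γ
  have := properlyDiscontinuousSMul_of_discrete hD Γ
  have hK := isReproducingKernel_bergmanKernel hD.isOpen
  have hKp := (hK.holo p).continuous.measurable
  obtain ⟨A', hA', C, hC⟩ := exists_enorm_sq_le_setLIntegral hD.isOpen hA
  obtain ⟨N, hN⟩ := exists_tsum_setLIntegral_le (G := Γ) hA' (μ := eucVolume D)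
    (hKp.enorm.pow_const 2).aemeasurable
  set v : Γ → ℝ≥0∞ := fun γ => ∫⁻ z in (fun z => γ⁻¹ • z) ⁻¹' A',
    ‖bergmanKernel D z p‖ₑ ^ 2 ∂(eucVolume D)
  have hv : ∑' γ, v γ ≠ ∞ := by
    refine ne_top_of_le_ne_top ?_ hN
    rw [hK.lintegral_enorm_sq]
    finiteness
  refine ⟨fun γ => C * (v γ).toReal, (ENNReal.summable_toReal hv).mul_left _, fun γ z hz => ?_⟩
  have hle : ‖slash 1 (γ : Aut D) (fun w => bergmanKernel D w p) z‖ₑ ^ 2 ≤ C * v γ := by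
    refine (hC _ ((hK.holo p).slash hD.isOpen 1 (γ : Aut D)) z hz).trans_eq ?_
    rw [(quasiInvariant_eucVolume hD.isOpen).lintegral_slash (γ : Aut D) (hK.holo p)
      hA'.measurableSet]
    rfl
  have hvγ : v γ ≠ ∞ := ne_top_of_le_ne_top hv (ENNReal.le_tsum γ)
  have hle' := ENNReal.toReal_mono (ENNReal.mul_ne_top ENNReal.coe_ne_top hvγ) hle
  rwa [ENNReal.toReal_pow, toReal_enorm, ENNReal.toReal_mul, ENNReal.coe_toReal] at hle'

variable (k : ℕ) (ρ : Γ →* Matrix.unitaryGroup (Fin m) ℂ) (j : Fin m) (p : D)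

theorem poincareTerm_apply (γ : Γ) (z : D) (i : Fin m) :
    poincareTerm k ρ j p γ z i = bergmanConst D k * (ρ γ⁻¹ : Matrix (Fin m) (Fin m) ℂ) i j *
      slash 1 (γ : Aut D) (fun w => bergmanKernel D w p) z ^ k := by
  simp only [poincareTerm, seed, Matrix.mulVec_single, Pi.smul_apply, Matrix.col_apply,
    MulOpposite.smul_eq_mul_unop, MulOpposite.unop_op, smul_eq_mul, slash, pow_one, mul_pow]
  rw [show ((γ : Aut D) • z : D) = γ • z from rfl]
  ring

theorem norm_poincareTerm_le (γ : Γ) (z : D) : ‖poincareTerm k ρ j p γ z‖ ≤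
    |bergmanConst D k| * ‖slash 1 (γ : Aut D) (fun w => bergmanKernel D w p) z‖ ^ k := by
  refine (pi_norm_le_iff_of_nonneg (by positivity)).2 fun i => ?_
  rw [poincareTerm_apply, norm_mul, norm_mul, norm_pow, Complex.norm_real, Real.norm_eq_abs]
  gcongr
  exact mul_le_of_le_one_right (abs_nonneg _) (entry_norm_bound_of_unitary (ρ γ⁻¹).2 i j)

theorem isHolomorphic_poincareTerm (hD : IsOpen D) (γ : Γ) :
    IsHolomorphic (poincareTerm k ρ j p γ) := by
  rw [isHolomorphic_pi]
  intro i
  simp_rw [poincareTerm_apply]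
  exact (isHolomorphic_const _).mul
    ((((isReproducingKernel_bergmanKernel hD).holo p).slash hD 1 _).pow k)

theorem jacobian_smul_poincareTerm (hD : IsOpen D) (γ δ : Γ) (z : D) :
    jacobian (γ : Aut D) z ^ k • poincareTerm k ρ j p δ (γ • z) =
      (ρ γ : Matrix (Fin m) (Fin m) ℂ).mulVec (poincareTerm k ρ j p (δ * γ) z) := by
  have hJ : jacobian ((δ * γ : Γ) : Aut D) z =
      jacobian (δ : Aut D) (γ • z) * jacobian (γ : Aut D) z := jacobian_mul hD _ _ z
  have hρ : (ρ γ : Matrix (Fin m) (Fin m) ℂ) * (ρ (δ * γ)⁻¹ : Matrix (Fin m) (Fin m) ℂ) =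
      (ρ δ⁻¹ : Matrix (Fin m) (Fin m) ℂ) := by
    rw [← Submonoid.coe_mul, ← map_mul, mul_inv_rev, mul_inv_cancel_left]
  rw [poincareTerm, poincareTerm, Matrix.mulVec_smul, Matrix.mulVec_mulVec, hρ, hJ, smul_smul,
    mul_smul δ γ z]
  congr 1
  ring

variable {k} (hk : 2 ≤ k) (hD : IsBoundedHomogeneousDomain D) [DiscreteTopology Γ]

include hk hD

theorem exists_summable_norm_poincareTerm_le {A : Set D} (hA : IsCompact A) :
    ∃ u : Γ → ℝ, Summable u ∧ ∀ γ : Γ, ∀ z ∈ A, ‖poincareTerm k ρ j p γ z‖ ≤ u γ := by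
  obtain ⟨u, hu, hub⟩ := exists_summable_norm_slash_bergmanKernel_sq_le (Γ := Γ) hD p hA
  obtain ⟨B, hB⟩ := hA.bddAbove_image (continuous_bergmanDiag hD.isOpen).continuousOn
  have hp := bergmanDiag_pos hD.isOpen hD.isBounded p
  refine ⟨fun γ => |bergmanConst D k| * (√(bergmanDiag p * B) ^ (k - 2) * u γ),
    (hu.mul_left _).mul_left _, fun γ z hz => (norm_poincareTerm_le k ρ j p γ z).trans ?_⟩
  set s := ‖slash 1 (γ : Aut D) (fun w => bergmanKernel D w p) z‖
  have hs : s ≤ √(bergmanDiag p * B) := by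
    refine Real.le_sqrt_of_sq_le
      ((norm_slash_bergmanKernel_sq_le hD.isOpen p (γ : Aut D) z).trans ?_)
    gcongr
    exact hB (mem_image_of_mem _ hz)
  have hsu : s ^ 2 ≤ u γ := hub γ z hz
  calc |bergmanConst D k| * s ^ k = |bergmanConst D k| * (s ^ (k - 2) * s ^ 2) := by
        rw [← pow_add, Nat.sub_add_cancel hk]
    _ ≤ |bergmanConst D k| * (√(bergmanDiag p * B) ^ (k - 2) * u γ) := by gcongr

theorem hasSumUniformlyOn_poincareTerm {A : Set D} (hA : IsCompact A) :
    HasSumUniformlyOn (fun (γ : Γ) (z : D) => poincareTerm k ρ j p γ z)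
      (poincareSeries k ρ j p) A := by
  obtain ⟨u, hu, hub⟩ := exists_summable_norm_poincareTerm_le ρ j p hk hD hA
  exact .of_norm_le_summable hu hub

theorem summableUniformlyOn_norm_poincareTerm {A : Set D} (hA : IsCompact A) :
    SummableUniformlyOn (fun (γ : Γ) (z : D) => ‖poincareTerm k ρ j p γ z‖) A := by
  obtain ⟨u, hu, hub⟩ := exists_summable_norm_poincareTerm_le ρ j p hk hD hA
  exact (HasSumUniformlyOn.of_norm_le_summable hu
    fun γ z hz => (norm_norm _).trans_le (hub γ z hz)).summableUniformlyOn

theorem hasSum_poincareTerm (z : D) :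
    HasSum (fun γ : Γ => poincareTerm k ρ j p γ z) (poincareSeries k ρ j p z) :=
  (hasSumUniformlyOn_poincareTerm ρ j p hk hD isCompact_singleton).hasSum rfl

theorem isHolomorphic_poincareSeries : IsHolomorphic (poincareSeries k ρ j p) := by
  classical
  refine isHolomorphic_of_tendstoUniformlyOn hD.isOpen (φ := atTop)
    (f := fun (s : Finset Γ) z => ∑ γ ∈ s, poincareTerm k ρ j p γ z) (fun s => ?_)
    fun A hA => hasSumUniformlyOn_iff_tendstoUniformlyOn.1
      (hasSumUniformlyOn_poincareTerm ρ j p hk hD hA)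
  induction s using Finset.induction_on with
  | empty => simpa only [Finset.sum_empty] using isHolomorphic_const (0 : Fin m → ℂ)
  | insert γ s hγ ih =>
    simp_rw [Finset.sum_insert hγ]
    exact (isHolomorphic_poincareTerm k ρ j p hD.isOpen γ).add ih

theorem poincareSeries_mem_automorphicForms :
    poincareSeries k ρ j p ∈ automorphicForms Γ k ρ := by
  refine ⟨isHolomorphic_poincareSeries ρ j p hk hD, fun γ z => ?_⟩
  have hleft := (hasSum_poincareTerm ρ j p hk hD (γ • z)).const_smul (jacobian (γ : Aut D) z ^ k)
  simp_rw [jacobian_smul_poincareTerm k ρ j p hD.isOpen] at hleft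
  have hright := (hasSum_poincareTerm ρ j p hk hD z).map
    (Matrix.mulVecLin (ρ γ : Matrix (Fin m) (Fin m) ℂ))
    (LinearMap.continuous_of_finiteDimensional _)
  exact hleft.unique ((Equiv.mulRight γ).hasSum_iff.2 hright)

end Series

/-! ### The Petersson product -/

section Unfolding

variable {G X : Type*} [Group G] [MulAction G X]

theorem isCompact_range_of_smul_invariant [TopologicalSpace X]
    [CompactSpace (MulAction.orbitRel.Quotient G X)] {Y : Type*} [TopologicalSpace Y] {f : X → Y}
    (hf : Continuous f) (hinv : ∀ (g : G) (x : X), f (g • x) = f x) : IsCompact (range f) := by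
  let fq : MulAction.orbitRel.Quotient G X → Y :=
    Quotient.lift f fun _ b ⟨g, hg⟩ => hg ▸ hinv g b
  have hfq : Continuous fq := hf.quotient_lift _
  have hrange : range fq = range f := range_quotient_lift (s := MulAction.orbitRel G X) _
  exact hrange ▸ isCompact_range hfq

theorem integrable_tsum {ι E : Type*} [Countable ι] [NormedAddCommGroup E] [CompleteSpace E]
    [MeasurableSpace X] {μ : Measure X} {f : ι → X → E} (hf : ∀ i, AEStronglyMeasurable (f i) μ)
    (hsum : ∑' i, ∫⁻ x, ‖f i x‖ₑ ∂μ ≠ ∞) : Integrable (fun x => ∑' i, f i x) μ := by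
  have hlim : ∀ᵐ x ∂μ, HasSum (fun i => f i x) (∑' i, f i x) := by
    simp_rw [← eLpNorm_one_eq_lintegral_enorm] at hsum
    filter_upwards [summable_norm_of_tsum_eLpNorm_ne_top le_rfl hf hsum] with x hx
    exact hx.of_norm.hasSum
  refine ⟨aestronglyMeasurable_of_tendsto_ae atTop (fun s => ?_) hlim, ?_⟩
  · exact Finset.aestronglyMeasurable_fun_sum s fun i _ => hf i
  · calc ∫⁻ x, ‖∑' i, f i x‖ₑ ∂μ ≤ ∫⁻ x, ∑' i, ‖f i x‖ₑ ∂μ :=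
        lintegral_mono fun x => enorm_tsum_le_tsum_enorm
      _ = ∑' i, ∫⁻ x, ‖f i x‖ₑ ∂μ := lintegral_tsum fun i => (hf i).enorm
      _ < ∞ := hsum.lt_top

theorem integrableOn_and_integral_tsum_smul [Countable G] [MeasurableSpace X]
    [MeasurableConstSMul G X] {μ : Measure X} [SMulInvariantMeasure G X μ] {E : Type*}
    [NormedAddCommGroup E] [NormedSpace ℝ E] [CompleteSpace E] {𝓕 : Set X}
    (h𝓕 : IsFundamentalDomain G 𝓕 μ) {f : X → E} (hf : Integrable f μ) :
    IntegrableOn (fun x => ∑' g : G, f (g • x)) 𝓕 μ ∧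
      ∫ x in 𝓕, ∑' g : G, f (g • x) ∂μ = ∫ x, f x ∂μ := by
  have hm (g : G) : AEStronglyMeasurable (fun x => f (g • x)) (μ.restrict 𝓕) :=
    (hf.aestronglyMeasurable.comp_measurePreserving (measurePreserving_smul g μ)).restrict
  have hsum : ∑' g : G, ∫⁻ x in 𝓕, ‖f (g • x)‖ₑ ∂μ ≠ ∞ := by
    rw [← h𝓕.lintegral_eq_tsum'' fun x => ‖f x‖ₑ]
    exact hf.2.ne
  exact ⟨integrable_tsum hm hsum,
    by rw [integral_tsum hm hsum, ← h𝓕.integral_eq_tsum'' f hf]⟩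

end Unfolding

theorem dotProduct_star_mulVec_unitary {ι R : Type*} [Fintype ι] [DecidableEq ι] [CommRing R]
    [StarRing R] (U : Matrix.unitaryGroup ι R) (v w : ι → R) :
    dotProduct ((U : Matrix ι ι R).mulVec v) (star ((U : Matrix ι ι R).mulVec w)) =
      dotProduct v (star w) := by
  have hU : (U : Matrix ι ι R).conjTranspose * (U : Matrix ι ι R) = 1 :=
    Matrix.UnitaryGroup.star_mul_self U
  rw [Matrix.star_mulVec, dotProduct_comm, ← Matrix.dotProduct_mulVec, Matrix.mulVec_mulVec, hU,
    Matrix.one_mulVec, dotProduct_comm]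

section Petersson

variable {n m : ℕ} {D : Set (Fin n → ℂ)} {Γ : Subgroup (Aut D)} {k : ℕ}
  {ρ : Γ →* Matrix.unitaryGroup (Fin m) ℂ} {F H : D → Fin m → ℂ}

theorem bergmanKernel_self_smul (hD : IsOpen D) (g : Aut D) (z : D) :
    bergmanKernel D (g • z) (g • z) * (jacobian g z * conj (jacobian g z)) =
      bergmanKernel D z z := by
  rw [Complex.mul_conj, Complex.normSq_eq_norm_sq, ← ofReal_bergmanDiag hD,
    ← ofReal_bergmanDiag hD, ← bergmanDiag_smul hD g z]
  push_cast
  rfl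

theorem peterssonDensity_smul (hD : IsOpen D) (hF : F ∈ automorphicForms Γ k ρ)
    (hH : H ∈ automorphicForms Γ k ρ) (γ : Γ) (z : D) :
    peterssonDensity k F H (γ • z) = peterssonDensity k F H z := by
  have hJ := jacobian_ne_zero hD (γ : Aut D) z
  have hJ' : conj (jacobian (γ : Aut D) z) ≠ 0 := (map_ne_zero _).2 hJ
  have hdot := dotProduct_star_mulVec_unitary (ρ γ) (F z) (H z)
  rw [← hF.2 γ z, ← hH.2 γ z, star_smul, smul_dotProduct, dotProduct_smul, smul_eq_mul,
    smul_eq_mul, RCLike.star_def, map_pow] at hdot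
  rw [peterssonDensity, peterssonDensity, ← hdot, ← bergmanKernel_self_smul hD (γ : Aut D) z,
    mul_pow, mul_pow]
  change _ * (bergmanKernel D ((γ : Aut D) • z) ((γ : Aut D) • z) ^ k)⁻¹ = _
  field_simp

theorem continuous_peterssonDensity (hD : IsOpen D) (hb : Bornology.IsBounded D)
    (hF : Continuous F) (hH : Continuous H) : Continuous (peterssonDensity k F H) := by
  have hdiag : Continuous fun z => bergmanKernel D z z :=
    (isReproducingKernel_bergmanKernel hD).continuous_diag hD (evalBounded_eucVolume hD)
  refine .mul ?_ ((hdiag.pow k).inv₀ fun z => pow_ne_zero k (bergmanKernel_self_ne_zero hD hb z))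
  simp only [dotProduct, Pi.star_apply]
  fun_prop

theorem norm_sq_le_norm_peterssonDensity_mul (hD : IsOpen D) (hb : Bornology.IsBounded D)
    (H : D → Fin m → ℂ) (j : Fin m) (z : D) :
    ‖H z j‖ ^ 2 ≤ ‖peterssonDensity k H H z‖ * bergmanDiag z ^ k := by
  have hpos := bergmanDiag_pos hD hb z
  have hdot : dotProduct (H z) (star (H z)) = ((∑ i, ‖H z i‖ ^ 2 : ℝ) : ℂ) := by
    simp only [dotProduct, Pi.star_apply, RCLike.star_def, Complex.mul_conj,
      Complex.normSq_eq_norm_sq, Complex.ofReal_sum]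
  rw [peterssonDensity, hdot, ← ofReal_bergmanDiag hD, norm_mul, norm_inv, norm_pow,
    Complex.norm_real, Complex.norm_real, Real.norm_of_nonneg hpos.le,
    Real.norm_of_nonneg (by positivity), inv_mul_cancel_right₀ (pow_pos hpos k).ne']
  exact Finset.single_le_sum (f := fun i => ‖H z i‖ ^ 2) (fun _ _ => sq_nonneg _)
    (Finset.mem_univ j)

theorem exists_norm_sq_le_of_mem_automorphicForms (hD : IsOpen D) (hb : Bornology.IsBounded D)
    [CompactSpace (MulAction.orbitRel.Quotient Γ D)] (hH : H ∈ automorphicForms Γ k ρ)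
    (j : Fin m) : ∃ M : ℝ, ∀ z, ‖H z j‖ ^ 2 ≤ M * bergmanDiag z ^ k := by
  obtain ⟨M, hM⟩ := (isCompact_range_of_smul_invariant (G := Γ)
    (continuous_peterssonDensity (k := k) hD hb hH.1.continuous hH.1.continuous).norm
    fun γ z => congrArg norm (peterssonDensity_smul hD hH hH γ z)).bddAbove
  refine ⟨M, fun z => (norm_sq_le_norm_peterssonDensity_mul (k := k) hD hb H j z).trans ?_⟩
  have := bergmanDiag_pos hD hb z
  gcongr
  exact hM ⟨z, rfl⟩

theorem peterssonDensity_poincareTerm (hD : IsOpen D) (hH : H ∈ automorphicForms Γ k ρ)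
    (j : Fin m) (p : D) (γ : Γ) (z : D) :
    peterssonDensity k H (poincareTerm k ρ j p γ) z =
      bergmanConst D k * reproducingIntegrand k (fun w => H w j) p (γ • z) := by
  have hJ := jacobian_ne_zero hD (γ : Aut D) z
  have hJ' : conj (jacobian (γ : Aut D) z) ≠ 0 := (map_ne_zero _).2 hJ
  have hinv : (ρ γ⁻¹ : Matrix (Fin m) (Fin m) ℂ) =
      (ρ γ : Matrix (Fin m) (Fin m) ℂ).conjTranspose := by
    rw [map_inv]
    rfl
  have hdot : dotProduct (H z) (star (poincareTerm k ρ j p γ z)) =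
      bergmanConst D k * conj (jacobian (γ : Aut D) z) ^ k *
        (jacobian (γ : Aut D) z ^ k * H (γ • z) j * bergmanKernel D p (γ • z) ^ k) := by
    rw [poincareTerm, star_smul, dotProduct_smul, hinv, Matrix.star_mulVec,
      Matrix.conjTranspose_conjTranspose, dotProduct_comm, ← Matrix.dotProduct_mulVec,
      ← hH.2 γ z, seed, ← Pi.single_star, single_dotProduct,
      (isReproducingKernel_bergmanKernel hD).hermitian p]
    simp only [Pi.smul_apply, smul_eq_mul, RCLike.star_def, map_mul, map_pow, Complex.conj_ofReal]
    ring
  rw [peterssonDensity, hdot, reproducingIntegrand, Complex.ofReal_inv, Complex.ofReal_pow,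
    ofReal_bergmanDiag hD, ← bergmanKernel_self_smul hD (γ : Aut D) z, mul_pow, mul_pow]
  change _ = _ * (_ * (bergmanKernel D ((γ : Aut D) • z) ((γ : Aut D) • z) ^ k)⁻¹)
  field_simp

theorem smulInvariantMeasure_invVolume (hD : IsOpen D) (hb : Bornology.IsBounded D)
    (Γ : Subgroup (Aut D)) : SMulInvariantMeasure Γ D (invVolume D) := by
  refine ⟨fun γ s hs => ?_⟩
  have h := (quasiInvariant_invVolume hD hb).measurePreserving hD (γ : Aut D)
  simp only [pow_zero] at h
  rw [show (fun _ : D => (1 : ℝ≥0∞)) = 1 from rfl, withDensity_one] at h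
  exact h.measure_preimage hs.nullMeasurableSet

theorem hasSum_peterssonDensity_poincareSeries (hD : IsBoundedHomogeneousDomain D)
    [DiscreteTopology Γ] (hk : 2 ≤ k) (hH : H ∈ automorphicForms Γ k ρ) (j : Fin m) (p z : D) :
    HasSum (fun γ : Γ =>
        bergmanConst D k * reproducingIntegrand k (fun w => H w j) p (γ • z))
      (peterssonDensity k H (poincareSeries k ρ j p) z) := by
  let pairing : (Fin m → ℂ) →+ ℂ := AddMonoidHom.mk'
    (fun v => dotProduct (H z) (star v) * (bergmanKernel D z z ^ k)⁻¹)
    fun v w => by rw [star_add, dotProduct_add, add_mul]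
  have hpairing : Continuous pairing := by
    change Continuous fun v : Fin m → ℂ => (∑ i, H z i * star (v i)) * (bergmanKernel D z z ^ k)⁻¹
    fun_prop
  simp_rw [← peterssonDensity_poincareTerm hD.isOpen hH]
  exact (hasSum_poincareTerm ρ j p hk hD z).map pairing hpairing

theorem petersson_poincareSeries (hD : IsBoundedHomogeneousDomain D) [DiscreteTopology Γ]
    [CompactSpace (MulAction.orbitRel.Quotient Γ D)] (hk : 2 ≤ k)
    (hH : H ∈ automorphicForms Γ k ρ) (j : Fin m) (p : D) {𝓕 : Set D}
    (h𝓕 : IsFundamentalDomain Γ 𝓕 (invVolume D)) :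
    IntegrableOn (peterssonDensity k H (poincareSeries k ρ j p)) 𝓕 (invVolume D) ∧
      petersson 𝓕 k H (poincareSeries k ρ j p) = H p j := by
  have := countable_of_discrete hD.isOpen Γ
  have := smulInvariantMeasure_invVolume hD.isOpen hD.isBounded Γ
  have : MeasurableConstSMul Γ D := ⟨fun γ => (continuous_aut_smul (γ : Aut D)).measurable⟩
  have hHj : IsHolomorphic fun w => H w j := isHolomorphic_pi.1 hH.1 j
  obtain ⟨M, hM⟩ := exists_norm_sq_le_of_mem_automorphicForms hD.isOpen hD.isBounded hH j
  have hdens : peterssonDensity k H (poincareSeries k ρ j p) = fun z =>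
      ∑' γ : Γ, bergmanConst D k * reproducingIntegrand k (fun w => H w j) p (γ • z) :=
    funext fun z => (hasSum_peterssonDensity_poincareSeries hD hk hH j p z).tsum_eq.symm
  obtain ⟨hintegrable, heq⟩ := integrableOn_and_integral_tsum_smul h𝓕
    ((integrable_reproducingIntegrand hM hD.isOpen hD.isBounded hk hHj p).const_mul
      (bergmanConst D k : ℂ))
  rw [petersson, hdens]
  exact ⟨hintegrable, by rw [heq, integral_const_mul,
    bergmanConst_mul_integral_reproducingIntegrand hD hM hk hHj p]⟩

end Petersson

end PoincareSeries

open PoincareSeries in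
theorem proposition3p2_general {n : ℕ} {D : Set (Fin n → ℂ)} (hD : IsBoundedHomogeneousDomain D)
    (Γ : Subgroup (Aut D)) [DiscreteTopology Γ] [CompactSpace (MulAction.orbitRel.Quotient Γ D)]
    {m : ℕ} (ρ : Γ →* Matrix.unitaryGroup (Fin m) ℂ) {k : ℕ} (hk : 2 ≤ k) (j : Fin m) (p : D) :
    (∀ A : Set D, IsCompact A →
      SummableUniformlyOn (fun (γ : Γ) (z : D) => ‖poincareTerm k ρ j p γ z‖) A ∧
      HasSumUniformlyOn (fun (γ : Γ) (z : D) => poincareTerm k ρ j p γ z)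
        (poincareSeries k ρ j p) A) ∧
    poincareSeries k ρ j p ∈ automorphicForms Γ k ρ ∧
    (∃ 𝓕 : Set D, IsFundamentalDomain Γ 𝓕 (invVolume D)) ∧
    ∀ 𝓕 : Set D, IsFundamentalDomain Γ 𝓕 (invVolume D) → ∀ H ∈ automorphicForms Γ k ρ,
      IntegrableOn (peterssonDensity k H (poincareSeries k ρ j p)) 𝓕 (invVolume D) ∧
      petersson 𝓕 k H (poincareSeries k ρ j p) = H p j :=
  ⟨fun _ hA => ⟨summableUniformlyOn_norm_poincareTerm ρ j p hk hD hA,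
      hasSumUniformlyOn_poincareTerm ρ j p hk hD hA⟩,
    poincareSeries_mem_automorphicForms ρ j p hk hD, exists_isFundamentalDomain hD,
    fun _ h𝓕 _ hH => petersson_poincareSeries hD hk hH j p h𝓕⟩

theorem proposition3p2 {n : ℕ} (hn : 1 ≤ n) (D : Set (Fin n → ℂ))
    (hD : PoincareSeries.IsBoundedSymmetricDomain D)
    (Γ : Subgroup (PoincareSeries.Aut D)) (hΓ : PoincareSeries.IsSmoothCocompactLattice Γ)
    {m : ℕ} (ρ : Γ →* Matrix.unitaryGroup (Fin m) ℂ) :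
    ∃ k₀ : ℕ, ∀ k : ℕ, k₀ ≤ k → ∀ (j : Fin m) (p : D),
      -- absolute and uniform convergence on compact sets, with sum `Θ_p^{(j;k)}`
      (∀ A : Set D, IsCompact A →
        SummableUniformlyOn
          (fun (γ : Γ) (z : D) => ‖PoincareSeries.poincareTerm k ρ j p γ z‖) A ∧
        HasSumUniformlyOn (fun (γ : Γ) (z : D) => PoincareSeries.poincareTerm k ρ j p γ z)
          (PoincareSeries.poincareSeries k ρ j p) A) ∧
      -- `Θ_p^{(j;k)}` is an automorphic form, and its inner products reproduce the values at `p`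
      PoincareSeries.poincareSeries k ρ j p ∈ PoincareSeries.automorphicForms Γ k ρ ∧
      (∃ 𝓕 : Set D,
        MeasureTheory.IsFundamentalDomain Γ 𝓕 (PoincareSeries.invVolume D)) ∧
      ∀ 𝓕 : Set D,
        MeasureTheory.IsFundamentalDomain Γ 𝓕 (PoincareSeries.invVolume D) →
        ∀ H ∈ PoincareSeries.automorphicForms Γ k ρ,
          MeasureTheory.IntegrableOn
            (PoincareSeries.peterssonDensity k H (PoincareSeries.poincareSeries k ρ j p)) 𝓕
            (PoincareSeries.invVolume D) ∧
          PoincareSeries.petersson 𝓕 k H (PoincareSeries.poincareSeries k ρ j p) = H p j := by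
  have := hΓ.discrete
  have := hΓ.compact
  exact ⟨2, fun _ hk j p => proposition3p2_general
    ⟨hD.isOpen, hD.isConnected, hD.isBounded, hD.transitive⟩ Γ ρ hk j p⟩
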